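/- Consider the following dual-pivot quicksort $\textsc{Count}(A,\mathit{left},\mathit{right})$ on an array $A$ with distinct entries. If $\mathit{right}\le\mathit{left}$, do nothing. Otherwise let $p<q$ be the two entries $A[\mathit{left}]$, $A[\mathit{right}]$ in increasing order, set $i\gets\mathit{left}+1$, $k\gets\mathit{right}-1$, $j\gets i$, $d\gets0$, and while $j\le k$ do the following. - If $d\ge0$: if $A[j]<p$, swap $A[i]$ and $A[j]$ and increase $i,j,d$ by $1$; else if $A[j]<q$, increase $j$ by $1$; else swap $A[j]$ and $A[k]$ and decrease $k,d$ by $1$. - If $d<0$: if $A[k]>q$, decrease $k,d$ by $1$; else if $A[k]<p$, perform the operation rotate3, i.e. $\mathit{tmp}\gets A[k]$, $A[k]\gets A[j]$, $A[j]\gets A[i]$, $A[i]\gets\mathit{tmp}$, and increase $i,j,d$ by $1$; else swap $A[j]$ and $A[k]$ and increase $j$ by $1$. After the loop, perform $A[\mathit{left}]\gets A[i-1]$, $A[i-1]\gets p$, and then $A[\mathit{right}]\gets A[k+1]$, $A[k+1]\gets q$ (counted as two swaps); finally call $\textsc{Count}$ on the ranges $(\mathit{left},i-2)$, $(i,k)$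 and $(k+2,\mathit{right})$. Every executed swap counts as one swap (also when its two positions coincide), and every rotate3 counts as $3/2$ swaps. Let $\mathcal{S}_n$ be the number of swaps executed by $\textsc{Count}$ on a uniformly random permutation of length $n$, and let $\mathcal{H}_n=\sum_{k=1}^n\frac1k$ and $\mathcal{H}_n^{\mathrm{alt}}=\sum_{k=1}^n\frac{(-1)^k}{k}$. Then for all $n\ge4$ $$\begin{aligned}\mathbb{E}[\mathcal{S}_n]={}&\frac34 n\mathcal{H}_n+\frac1{20}n\mathcal{H}_n^{\mathrm{alt}}-\frac45 n+\frac34\mathcal{H}_n+\frac1{20}\mathcal{H}_n^{\mathrm{alt}}-\frac{23}{160}-\frac{(-1)^n}{40}\\&-\frac{\mathbf 1_{\{n\text{ even}\}}}{320}\left(\frac1{n-3}+\frac3{n-1}\right)+\frac{\mathbf 1_{\{n\text{ odd}\}}}{320}\left(\frac3{n-2}+\frac1n\right),\end{aligned}$$ and, as $n\to\infty$, $$\mathbb{E}[\mathcal{S}_n]=\frac34 n\log n+A_s n+\frac34\log n+O(1),\qquad A_s=\frac34\gamma-\frac1{20}\log 2-\frac45=-0.401\ldots,$$ where $\gamma$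 is the Euler–Mascheroni constant. -/

import Mathlib

open Finset BigOperators Filter Asymptotics

namespace DualPivotCount

variable {α : Type*} [LinearOrder α]

/-- The local variables of one partitioning stage: the array `A` (indexed by integer positions), the
indices `i`, `j`, `k`, the difference `d` (small minus large elements seen so far), and `swaps`, the
swaps executed so far, a `rotate3` being counted as `3/2` swaps. -/
structure State (α : Type*) where
  A : ℤ → α
  i : ℤ
  j : ℤ
  k : ℤ
  d : ℤ
  swaps : ℚ

/-- Exchange the entries of `A` at positions `x` and `y`. -/
def swapAt (A : ℤ → α) (x y : ℤ) : ℤ → α :=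
  Function.update (Function.update A x (A y)) y (A x)

/-- `rotate3 (A[z], A[y], A[x])`: the assignments
`tmp ← A[z]; A[z] ← A[y]; A[y] ← A[x]; A[x] ← tmp`, executed one after the other. -/
def rotate3 (A : ℤ → α) (z y x : ℤ) : ℤ → α :=
  let tmp := A z
  let A₁ := Function.update A z (A y)
  let A₂ := Function.update A₁ y (A₁ x)
  Function.update A₂ x tmp

/-- One execution of the body of the partitioning loop, with pivots `p` and `q`. Every executed swap
instruction is counted, also if it exchanges a position with itself. -/
def step (p q : α) (s : State α) : State α :=
  if 0 ≤ s.d then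
    if s.A s.j < p then
      { A := swapAt s.A s.i s.j, i := s.i + 1, j := s.j + 1, k := s.k, d := s.d + 1,
        swaps := s.swaps + 1 }
    else if s.A s.j < q then
      { s with j := s.j + 1 }
    else
      { s with A := swapAt s.A s.j s.k, k := s.k - 1, d := s.d - 1, swaps := s.swaps + 1 }
  else
    if q < s.A s.k then
      { s with k := s.k - 1, d := s.d - 1 }
    else if s.A s.k < p then
      { A := rotate3 s.A s.k s.j s.i, i := s.i + 1, j := s.j + 1, k := s.k, d := s.d + 1,
        swaps := s.swaps + 3 / 2 }
    else
      { s with A := swapAt s.A s.j s.k, j := s.j + 1, swaps := s.swaps + 1 }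

theorem step_gap (p q : α) (s : State α) :
    (step p q s).k - (step p q s).j = s.k - s.j - 1 := by
  unfold step
  split_ifs <;> simp <;> ring

/-- The loop `while j ≤ k do step`. -/
def loop (p q : α) (s : State α) : State α :=
  if s.j ≤ s.k then loop p q (step p q s) else s
termination_by (s.k - s.j + 1).toNat
decreasing_by
  have := step_gap p q s
  omega

theorem step_bounds (p q : α) (s : State α) (hij : s.i ≤ s.j) :
    s.i ≤ (step p q s).i ∧ (step p q s).i ≤ (step p q s).j ∧ (step p q s).k ≤ s.k := by
  unfold step
  split_ifs <;> refine ⟨?_, ?_, ?_⟩ <;> simp <;> omega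

theorem loop_bounds (p q : α) (s : State α) (hij : s.i ≤ s.j) (hjk : s.j ≤ s.k + 1) :
    s.i ≤ (loop p q s).i ∧ (loop p q s).i ≤ (loop p q s).k + 1 ∧ (loop p q s).k ≤ s.k := by
  induction s using loop.induct (p := p) (q := q) with
  | case1 s h ih =>
    rw [loop, if_pos h]
    have h₁ := step_bounds p q s hij
    have h₂ := step_gap p q s
    have h₃ := ih h₁.2.1 (by omega)
    exact ⟨by omega, by omega, by omega⟩
  | case2 s h =>
    rw [loop, if_neg h]
    exact ⟨le_refl _, by omega, le_refl _⟩

/-- The smaller pivot: the smaller one of the two outer entries. -/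
def pivotP (A : ℤ → α) (left right : ℤ) : α :=
  if A right < A left then A right else A left

/-- The larger pivot: the larger one of the two outer entries. -/
def pivotQ (A : ℤ → α) (left right : ℤ) : α :=
  if A right < A left then A left else A right

/-- The state in which the partitioning loop is left. -/
def afterLoop (A : ℤ → α) (left right : ℤ) : State α :=
  loop (pivotP A left right) (pivotQ A left right)
    { A := A, i := left + 1, j := left + 1, k := right - 1, d := 0, swaps := 0 }

/-- The array after both pivots have been brought to their final positions, by the assignments
`A[left] ← A[i-1]; A[i-1] ← p; A[right] ← A[k+1]; A[k+1] ← q`. -/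
def placePivots (p q : α) (left right : ℤ) (s : State α) : ℤ → α :=
  let A₁ := Function.update s.A left (s.A (s.i - 1))
  let A₂ := Function.update A₁ (s.i - 1) p
  let A₃ := Function.update A₂ right (A₂ (s.k + 1))
  Function.update A₃ (s.k + 1) q

theorem afterLoop_bounds (A : ℤ → α) {left right : ℤ} (h : left < right) :
    left + 1 ≤ (afterLoop A left right).i ∧
      (afterLoop A left right).i ≤ (afterLoop A left right).k + 1 ∧
      (afterLoop A left right).k ≤ right - 1 :=
  loop_bounds _ _ _ (le_refl _) (by simp; omega)

/-- The dual-pivot quicksort Count on the positions `left, …, right` of the array `A`. It returns the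
resulting array and the number of executed swaps; bringing the two pivots to their final positions
counts as two swaps. -/
def count (A : ℤ → α) (left right : ℤ) : (ℤ → α) × ℚ :=
  if h : right ≤ left then (A, 0)
  else
    let s := afterLoop A left right
    let A₀ := placePivots (pivotP A left right) (pivotQ A left right) left right s
    let r₁ := count A₀ left (s.i - 2)
    let r₂ := count r₁.1 s.i s.k
    let r₃ := count r₂.1 (s.k + 2) right
    (r₃.1, s.swaps + 2 + r₁.2 + r₂.2 + r₃.2)
termination_by (right - left + 1).toNat
decreasing_by
  all_goals
    have := afterLoop_bounds A (not_le.mp h)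
    omega

/-- The permutation `σ` of `{0, …, n-1}` as an array, with entries at the positions `0, …, n-1` (the
value elsewhere is irrelevant). -/
def inputArray {n : ℕ} (σ : Equiv.Perm (Fin n)) : ℤ → ℕ :=
  fun t => if h : 0 ≤ t ∧ t < n then (σ ⟨t.toNat, by omega⟩ : ℕ) else 0

/-- The number of swaps executed by Count when sorting the permutation `σ`. -/
def swapCount {n : ℕ} (σ : Equiv.Perm (Fin n)) : ℚ :=
  (count (inputArray σ) 0 ((n : ℤ) - 1)).2

/-- The expected number of swaps on a uniformly random permutation of length `n`: the average over
all permutations. -/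
noncomputable def expectedSwaps (n : ℕ) : ℝ :=
  𝔼 σ : Equiv.Perm (Fin n), (swapCount σ : ℝ)

/-- The alternating harmonic sum `∑_{k=1}^n (-1)^k / k`. -/
noncomputable def altHarmonic (n : ℕ) : ℝ :=
  ∑ k ∈ Finset.Icc 1 n, (-1 : ℝ) ^ k / k

/-- The coefficient of the linear term in the expansion of the expected number of swaps. -/
noncomputable def linearCoeff : ℝ :=
  3 / 4 * Real.eulerMascheroniConstant - 1 / 20 * Real.log 2 - 4 / 5

end DualPivotCount

/-! The expected cost is decomposed at the first partitioning stage. Two facts make the resulting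
recurrence explicit.

Randomness is preserved. Partitioning compares elements with the two pivots only, so permuting the
values inside the block of small, of medium or of large values permutes the contents of the matching
segment after the stage and changes nothing else (`splitArray_shiftPerm`). Averaging over these
permutations, each recursive call costs what a uniformly random permutation of its length costs
(`sum_segmentSwaps`).

The cost of the loop depends only on the word of classes small, medium, large (`loop_swaps`). One
step is a bijection between words and pairs of a letter and a shorter word, compatible with letter
counts, so on average the loop may as well read the word from left to right
(`sum_loopCost_eq_sum_scanCost`). A word with letter counts `s, m, l` comes from `2 * s! * m! * l!`
permutations (`card_word_eq`). The letters thus follow a Pólya urn: all count triples are equally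
likely, and the next letter is small, medium or large with odds `s + 1 : m + 1 : l + 1`. Summing the
cost of the next letter, which depends on the sign of `s - l`, gives the mean loop cost `5N/8 + (1 -
1/(N+1))/16` for even `N`, with `N + 2` in place of `N + 1` for odd `N` (`meanLoopCost_even_odd`).

Hence `E (N+2)` is the mean loop cost plus `2` plus a weighted sum of the `E s` with `s ≤ N`
(`meanSwaps_rec`). Second differences remove the sum and leave a linear recurrence between three
consecutive values, which the closed form satisfies; the values at `4` and `5` start the induction.
The asymptotics follow since `H n - log n - γ` and the alternating sum plus `log 2` are both
`O(1/n)`. -/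

namespace DualPivotCount

/-! ### Partitioning commutes with maps that respect the comparisons with the pivots -/

section Transfer

variable {α β : Type*}

/-- On the positions `l, …, r`, the array `B`, shifted by `c`, is the image under `g` of the array
`A`, whose entries lie in `V`. -/
def Related (g : α → β) (c l r : ℤ) (V : Set α) (A : ℤ → α) (B : ℤ → β) : Prop :=
  ∀ t, l ≤ t → t ≤ r → A t ∈ V ∧ B (t + c) = g (A t)

variable {g : α → β} {c l r : ℤ} {V : Set α} {A : ℤ → α} {B : ℤ → β}

theorem Related.mono (h : Related g c l r V A B) {l' r' : ℤ} (hl : l ≤ l') (hr : r' ≤ r) :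
    Related g c l' r' V A B :=
  fun t h₁ h₂ => h t (hl.trans h₁) (h₂.trans hr)

theorem Related.update (h : Related g c l r V A B) (x : ℤ) {v : α} {w : β} (hv : v ∈ V)
    (hw : w = g v) :
    Related g c l r V (Function.update A x v) (Function.update B (x + c) w) := by
  intro t h₁ h₂
  subst hw
  by_cases htx : t = x
  · subst htx
    simpa using hv
  · have : t + c ≠ x + c := by omega
    simpa [Function.update_of_ne htx, Function.update_of_ne this] using h t h₁ h₂

theorem Related.swapAt (h : Related g c l r V A B) {x y : ℤ} (hx : l ≤ x ∧ x ≤ r)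
    (hy : l ≤ y ∧ y ≤ r) :
    Related g c l r V (swapAt A x y) (swapAt B (x + c) (y + c)) :=
  (h.update x (h y hy.1 hy.2).1 (h y hy.1 hy.2).2).update y (h x hx.1 hx.2).1 (h x hx.1 hx.2).2

theorem Related.rotate3 (h : Related g c l r V A B) {x y z : ℤ} (hx : l ≤ x ∧ x ≤ r)
    (hy : l ≤ y ∧ y ≤ r) (hz : l ≤ z ∧ z ≤ r) :
    Related g c l r V (rotate3 A z y x) (rotate3 B (z + c) (y + c) (x + c)) := by
  have h₁ := h.update z (h y hy.1 hy.2).1 (h y hy.1 hy.2).2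
  have h₂ := h₁.update y (h₁ x hx.1 hx.2).1 (h₁ x hx.1 hx.2).2
  exact h₂.update x (h z hz.1 hz.2).1 (h z hz.1 hz.2).2

theorem Related.placePivots {p q : α} {s : State α} {s' : State β} (h : Related g c l r V s.A s'.A)
    (hi : s'.i = s.i + c) (hk : s'.k = s.k + c)
    (hli : l + 1 ≤ s.i) (hik : s.i ≤ s.k + 1) (hkr : s.k ≤ r - 1) (hpV : p ∈ V) (hqV : q ∈ V) :
    Related g c l r V (placePivots p q l r s)
      (placePivots (g p) (g q) (l + c) (r + c) s') := by
  have h₁ := h.update l (h (s.i - 1) (by omega) (by omega)).1 (h (s.i - 1) (by omega) (by omega)).2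
  have h₂ := h₁.update (s.i - 1) hpV rfl
  have h₃ := h₂.update r (h₂ (s.k + 1) (by omega) (by omega)).1
    (h₂ (s.k + 1) (by omega) (by omega)).2
  have h₄ := h₃.update (s.k + 1) hqV rfl
  unfold DualPivotCount.placePivots
  rw [hi, hk, show s.i + c - 1 = s.i - 1 + c by ring, show s.k + c + 1 = s.k + 1 + c by ring]
  exact h₄

variable [LinearOrder α] [LinearOrder β]

/-- A step makes no comparison except with a pivot, so `g` need not be monotone. This generality
matters: `g` will scramble the values of a whole block. -/
theorem step_related {p q : α} {p' q' : β} (hp : ∀ x ∈ V, g x < p' ↔ x < p)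
    (hq : ∀ x ∈ V, g x < q' ↔ x < q) (hq' : ∀ x ∈ V, q' < g x ↔ q < x) (s : State α)
    (hl : l ≤ s.i) (hij : s.i ≤ s.j) (hjk : s.j ≤ s.k) (hr : s.k ≤ r)
    (h : Related g c l r V s.A B) :
    ∃ B', step p' q' ⟨B, s.i + c, s.j + c, s.k + c, s.d, s.swaps⟩ =
        ⟨B', (step p q s).i + c, (step p q s).j + c, (step p q s).k + c, (step p q s).d,
          (step p q s).swaps⟩ ∧ Related g c l r V (step p q s).A B' := by
  have hi : l ≤ s.i ∧ s.i ≤ r := by omega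
  have hj : l ≤ s.j ∧ s.j ≤ r := by omega
  have hk : l ≤ s.k ∧ s.k ≤ r := by omega
  obtain ⟨hjV, hjB⟩ := h _ hj.1 hj.2
  obtain ⟨hkV, hkB⟩ := h _ hk.1 hk.2
  unfold step
  simp only [hjB, hkB, hp _ hjV, hq _ hjV, hp _ hkV, hq' _ hkV]
  split_ifs
  · refine ⟨_, ?_, h.swapAt hi hj⟩
    simp; omega
  · refine ⟨_, ?_, h⟩
    simp; omega
  · refine ⟨_, ?_, h.swapAt hj hk⟩
    simp; omega
  · refine ⟨_, ?_, h⟩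
    simp; omega
  · refine ⟨_, ?_, h.rotate3 hi hj hk⟩
    simp; omega
  · refine ⟨_, ?_, h.swapAt hj hk⟩
    simp; omega

theorem loop_related {p q : α} {p' q' : β} (hp : ∀ x ∈ V, g x < p' ↔ x < p)
    (hq : ∀ x ∈ V, g x < q' ↔ x < q) (hq' : ∀ x ∈ V, q' < g x ↔ q < x) (s : State α)
    (B : ℤ → β) (hl : l ≤ s.i) (hij : s.i ≤ s.j) (hr : s.k ≤ r)
    (h : Related g c l r V s.A B) :
    ∃ B', loop p' q' ⟨B, s.i + c, s.j + c, s.k + c, s.d, s.swaps⟩ =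
        ⟨B', (loop p q s).i + c, (loop p q s).j + c, (loop p q s).k + c, (loop p q s).d,
          (loop p q s).swaps⟩ ∧ Related g c l r V (loop p q s).A B' := by
  induction s using loop.induct (p := p) (q := q) generalizing B with
  | case1 s hjk ih =>
    obtain ⟨B₁, hB₁, hR⟩ := step_related hp hq hq' s hl hij hjk hr h
    have hb := step_bounds p q s hij
    obtain ⟨B₂, hB₂, hR₂⟩ := ih B₁ (by omega) hb.2.1 (by omega) hR
    refine ⟨B₂, ?_, ?_⟩
    · rw [loop, if_pos (by simpa using hjk), hB₁, hB₂, loop.eq_1 p q s, if_pos hjk]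
    · rwa [loop.eq_1 p q s, if_pos hjk]
  | case2 s hjk =>
    refine ⟨B, ?_, ?_⟩
    · rw [loop, if_neg (by simpa using hjk), loop.eq_1 p q s, if_neg hjk]
    · rwa [loop.eq_1 p q s, if_neg hjk]

theorem afterLoop_related (h : Related g c l r V A B)
    (hp : ∀ x ∈ V, g x < pivotP B (l + c) (r + c) ↔ x < pivotP A l r)
    (hq : ∀ x ∈ V, g x < pivotQ B (l + c) (r + c) ↔ x < pivotQ A l r)
    (hq' : ∀ x ∈ V, pivotQ B (l + c) (r + c) < g x ↔ pivotQ A l r < x) :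
    ∃ B', afterLoop B (l + c) (r + c) =
        ⟨B', (afterLoop A l r).i + c, (afterLoop A l r).j + c, (afterLoop A l r).k + c,
          (afterLoop A l r).d, (afterLoop A l r).swaps⟩ ∧
      Related g c l r V (afterLoop A l r).A B' := by
  have := loop_related hp hq hq' ⟨A, l + 1, l + 1, r - 1, 0, 0⟩ B (by simp) (by simp) (by simp) h
  unfold afterLoop
  rwa [show l + c + 1 = l + 1 + c by ring, show r + c - 1 = r - 1 + c by ring]

end Transfer

/-! ### Entries outside the range are untouched; the swap count depends on relative order only -/

section Locality

variable {α : Type*}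

theorem swapAt_of_ne (A : ℤ → α) {x y t : ℤ} (hx : t ≠ x) (hy : t ≠ y) : swapAt A x y t = A t := by
  simp [swapAt, Function.update_of_ne hx, Function.update_of_ne hy]

theorem rotate3_of_ne (A : ℤ → α) {x y z t : ℤ} (hx : t ≠ x) (hy : t ≠ y) (hz : t ≠ z) :
    rotate3 A z y x t = A t := by
  simp [rotate3, Function.update_of_ne hx, Function.update_of_ne hy, Function.update_of_ne hz]

theorem placePivots_of_ne (p q : α) {l r : ℤ} (s : State α) {t : ℤ} (h₁ : t ≠ l) (h₂ : t ≠ r)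
    (h₃ : t ≠ s.i - 1) (h₄ : t ≠ s.k + 1) : placePivots p q l r s t = s.A t := by
  simp only [placePivots, Function.update_of_ne h₁, Function.update_of_ne h₂,
    Function.update_of_ne h₃, Function.update_of_ne h₄]

variable [LinearOrder α]


theorem step_outside (p q : α) (s : State α) (hij : s.i ≤ s.j) (hjk : s.j ≤ s.k) {t : ℤ}
    (ht : t < s.i ∨ s.k < t) : (step p q s).A t = s.A t := by
  unfold step
  split_ifs
  any_goals rfl
  all_goals first
    | exact swapAt_of_ne _ (by omega) (by omega)
    | exact rotate3_of_ne _ (by omega) (by omega) (by omega)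

theorem loop_outside (p q : α) (s : State α) (hij : s.i ≤ s.j) {t : ℤ}
    (ht : t < s.i ∨ s.k < t) : (loop p q s).A t = s.A t := by
  induction s using loop.induct (p := p) (q := q) with
  | case1 s hjk ih =>
    have hb := step_bounds p q s hij
    rw [loop, if_pos hjk, ih hb.2.1 (by omega), step_outside p q s hij hjk ht]
  | case2 s hjk => rw [loop, if_neg hjk]

theorem afterLoop_outside (A : ℤ → α) {l r t : ℤ} (ht : t ≤ l ∨ r ≤ t) :
    (afterLoop A l r).A t = A t :=
  loop_outside _ _ _ le_rfl (by simp only; omega)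

/-- The array after partitioning, with both pivots in their final positions. -/
def partitioned (A : ℤ → α) (l r : ℤ) : ℤ → α :=
  placePivots (pivotP A l r) (pivotQ A l r) l r (afterLoop A l r)

theorem partitioned_outside (A : ℤ → α) {l r t : ℤ} (hlr : l < r) (ht : t < l ∨ r < t) :
    partitioned A l r t = A t := by
  have := afterLoop_bounds A hlr
  rw [partitioned, placePivots_of_ne _ _ _ (by omega) (by omega) (by omega) (by omega),
    afterLoop_outside A (by omega)]

theorem count_of_le (A : ℤ → α) {l r : ℤ} (h : r ≤ l) : count A l r = (A, 0) := by
  rw [count, dif_pos h]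

theorem count_of_lt (A : ℤ → α) {l r : ℤ} (h : l < r) :
    count A l r =
      let s := afterLoop A l r
      let r₁ := count (partitioned A l r) l (s.i - 2)
      let r₂ := count r₁.1 s.i s.k
      let r₃ := count r₂.1 (s.k + 2) r
      (r₃.1, s.swaps + 2 + r₁.2 + r₂.2 + r₃.2) := by
  rw [count, dif_neg (not_le.mpr h)]
  rfl

theorem count_outside (A : ℤ → α) (l r : ℤ) {t : ℤ} (ht : t < l ∨ r < t) :
    (count A l r).1 t = A t := by
  induction hm : (r - l + 1).toNat using Nat.strong_induction_on generalizing A l r with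
  | _ m ih =>
    rcases le_or_gt r l with h | h
    · rw [count_of_le A h]
    · have hb := afterLoop_bounds A h
      rw [count_of_lt A h]
      simp only
      rw [ih _ (by omega) _ _ _ (by omega) rfl, ih _ (by omega) _ _ _ (by omega) rfl,
        ih _ (by omega) _ _ _ (by omega) rfl, partitioned_outside A h ht]

variable {β : Type*} {g : α → β} {c l r : ℤ} {V : Set α} {A : ℤ → α} {B : ℤ → β}

theorem pivotP_mem (h : Related g c l r V A B) (hlr : l ≤ r) : pivotP A l r ∈ V := by
  unfold pivotP
  split_ifs
  exacts [(h r hlr le_rfl).1, (h l le_rfl hlr).1]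

theorem pivotQ_mem (h : Related g c l r V A B) (hlr : l ≤ r) : pivotQ A l r ∈ V := by
  unfold pivotQ
  split_ifs
  exacts [(h l le_rfl hlr).1, (h r hlr le_rfl).1]

variable [LinearOrder β]

theorem partitioned_related (hlr : l < r) (h : Related g c l r V A B)
    (hP : pivotP B (l + c) (r + c) = g (pivotP A l r))
    (hQ : pivotQ B (l + c) (r + c) = g (pivotQ A l r))
    (hp : ∀ x ∈ V, g x < g (pivotP A l r) ↔ x < pivotP A l r)
    (hq : ∀ x ∈ V, g x < g (pivotQ A l r) ↔ x < pivotQ A l r)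
    (hq' : ∀ x ∈ V, g (pivotQ A l r) < g x ↔ pivotQ A l r < x) :
    (afterLoop B (l + c) (r + c)).i = (afterLoop A l r).i + c ∧
    (afterLoop B (l + c) (r + c)).k = (afterLoop A l r).k + c ∧
    (afterLoop B (l + c) (r + c)).swaps = (afterLoop A l r).swaps ∧
    Related g c l r V (partitioned A l r) (partitioned B (l + c) (r + c)) := by
  rw [← hP] at hp
  rw [← hQ] at hq hq'
  obtain ⟨B', hB', hR⟩ := afterLoop_related h hp hq hq'
  have hb := afterLoop_bounds A hlr
  refine ⟨by rw [hB'], by rw [hB'], by rw [hB'], ?_⟩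
  unfold partitioned
  rw [hP, hQ]
  exact Related.placePivots (by rw [hB']; exact hR) (by rw [hB']) (by rw [hB']) hb.1 hb.2.1 hb.2.2
    (pivotP_mem h hlr.le) (pivotQ_mem h hlr.le)

/-- Sorting a strictly monotone image of an array executes the same swaps. -/
theorem count_related (hg : StrictMonoOn g V) (h : Related g c l r V A B) :
    (count B (l + c) (r + c)).2 = (count A l r).2 ∧
      Related g c l r V (count A l r).1 (count B (l + c) (r + c)).1 := by
  induction hm : (r - l + 1).toNat using Nat.strong_induction_on generalizing A B l r with
  | _ m ih =>
    rcases le_or_gt r l with hlr | hlr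
    · rw [count_of_le A hlr, count_of_le B (by omega)]
      exact ⟨rfl, h⟩
    · have hb := afterLoop_bounds A hlr
      have hlV := h l le_rfl hlr.le
      have hrV := h r hlr.le le_rfl
      have hlt : B (r + c) < B (l + c) ↔ A r < A l := by
        rw [hlV.2, hrV.2, hg.lt_iff_lt hrV.1 hlV.1]
      have hP : pivotP B (l + c) (r + c) = g (pivotP A l r) := by
        unfold pivotP
        simp only [hlt]
        split_ifs
        exacts [hrV.2, hlV.2]
      have hQ : pivotQ B (l + c) (r + c) = g (pivotQ A l r) := by
        unfold pivotQ
        simp only [hlt]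
        split_ifs
        exacts [hlV.2, hrV.2]
      have hPV := pivotP_mem h hlr.le
      have hQV := pivotQ_mem h hlr.le
      obtain ⟨hi, hk, hs, hR⟩ := partitioned_related hlr h hP hQ
        (fun x hx => hg.lt_iff_lt hx hPV) (fun x hx => hg.lt_iff_lt hx hQV)
        (fun x hx => hg.lt_iff_lt hQV hx)
      set i := (afterLoop A l r).i
      set k := (afterLoop A l r).k
      -- The induction hypothesis speaks only of the subrange, but the next call needs the relation
      -- on all of `l, …, r`; outside the subrange neither array has changed.
      have key : ∀ (l' r' : ℤ) (A' : ℤ → α) (B' : ℤ → β), l ≤ l' → r' ≤ r → r' - l' < r - l →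
          Related g c l r V A' B' →
          (count B' (l' + c) (r' + c)).2 = (count A' l' r').2 ∧
            Related g c l r V (count A' l' r').1 (count B' (l' + c) (r' + c)).1 := by
        intro l' r' A' B' h₁ h₂ h₃ hR'
        obtain ⟨he, hR''⟩ := ih _ (by omega) (hR'.mono h₁ h₂) rfl
        refine ⟨he, fun t ht₁ ht₂ => ?_⟩
        by_cases ht : l' ≤ t ∧ t ≤ r'
        · exact hR'' t ht.1 ht.2
        · rw [count_outside A' l' r' (by omega), count_outside B' (l' + c) (r' + c) (by omega)]
          exact hR' t ht₁ ht₂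
      rw [count_of_lt A hlr, count_of_lt B (by omega)]
      simp only [hi, hk, hs]
      rw [show i + c - 2 = i - 2 + c by ring, show k + c + 2 = k + 2 + c by ring]
      obtain ⟨e₁, R₁⟩ := key l (i - 2) _ _ le_rfl (by omega) (by omega) hR
      obtain ⟨e₂, R₂⟩ := key i k _ _ (by omega) (by omega) (by omega) R₁
      obtain ⟨e₃, R₃⟩ := key (k + 2) r _ _ (by omega) le_rfl (by omega) R₂
      exact ⟨by rw [e₁, e₂, e₃], R₃⟩

/-- The case `g = id` of `count_related`. It allows each of the three successive recursive calls to
be evaluated on the array as it was right after partitioning. -/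
theorem count_congr {A B : ℤ → α} {l r : ℤ} (h : ∀ t, l ≤ t → t ≤ r → B t = A t) :
    (count B l r).2 = (count A l r).2 := by
  have := (count_related (g := id) (c := 0) (l := l) (r := r) (V := Set.univ) (A := A) (B := B)
    (strictMono_id.strictMonoOn _) (fun t h₁ h₂ => ⟨trivial, by simpa using h t h₁ h₂⟩)).1
  simpa using this

end Locality

/-! ### Partitioning permutes the entries -/

section Rearrangement

variable {α : Type*}

theorem swapAt_eq_comp (A : ℤ → α) (x y : ℤ) : swapAt A x y = A ∘ Equiv.swap x y := by
  funext t
  simp only [swapAt, Function.comp, Function.update_apply, Equiv.swap_apply_def]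
  split_ifs <;> simp_all

theorem rotate3_eq_comp (A : ℤ → α) {x y z : ℤ} (hyz : y ≤ z) :
    rotate3 A z y x = A ∘ (Equiv.swap z y * Equiv.swap y x) := by
  funext t
  simp only [rotate3, Function.comp, Function.update_apply, Equiv.Perm.mul_apply,
    Equiv.swap_apply_def]
  split_ifs <;> first | rfl | (congr 1; omega)

/-- The array `B` arises from `A` by permuting the entries at the positions `l, …, r`. -/
def Rearranged (l r : ℤ) (A B : ℤ → α) : Prop :=
  ∃ π : Equiv.Perm ℤ, (∀ t, t < l ∨ r < t → π t = t) ∧ B = A ∘ π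

variable {l r : ℤ} {A B C : ℤ → α}

theorem Rearranged.refl (A : ℤ → α) : Rearranged l r A A := ⟨1, fun _ _ => rfl, rfl⟩

theorem Rearranged.trans (h : Rearranged l r A B) (h' : Rearranged l r B C) :
    Rearranged l r A C := by
  obtain ⟨π, hπ, rfl⟩ := h
  obtain ⟨ρ, hρ, rfl⟩ := h'
  exact ⟨π * ρ, fun t ht => by rw [Equiv.Perm.mul_apply, hρ t ht, hπ t ht], rfl⟩

theorem Rearranged.mono (h : Rearranged l r A B) {l' r' : ℤ} (hl : l' ≤ l) (hr : r ≤ r') :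
    Rearranged l' r' A B := by
  obtain ⟨π, hπ, rfl⟩ := h
  exact ⟨π, fun t ht => hπ t (by omega), rfl⟩

theorem Rearranged.swapAt (A : ℤ → α) {x y : ℤ} (hx : l ≤ x ∧ x ≤ r) (hy : l ≤ y ∧ y ≤ r) :
    Rearranged l r A (swapAt A x y) :=
  ⟨_, fun _ _ => Equiv.swap_apply_of_ne_of_ne (by omega) (by omega), swapAt_eq_comp A x y⟩

theorem Rearranged.rotate3 (A : ℤ → α) {x y z : ℤ} (hx : l ≤ x) (hxy : x ≤ y) (hyz : y ≤ z)
    (hz : z ≤ r) : Rearranged l r A (rotate3 A z y x) :=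
  ⟨_, fun _ _ => by
    rw [Equiv.Perm.mul_apply, Equiv.swap_apply_of_ne_of_ne (a := y) (by omega) (by omega),
      Equiv.swap_apply_of_ne_of_ne (by omega) (by omega)], rotate3_eq_comp A hyz⟩

theorem Rearranged.exists_index (h : Rearranged l r A B) {t : ℤ} (hl : l ≤ t) (hr : t ≤ r) :
    ∃ u, l ≤ u ∧ u ≤ r ∧ B t = A u := by
  obtain ⟨π, hπ, rfl⟩ := h
  refine ⟨π t, ?_⟩
  by_contra hcon
  have hout : π t < l ∨ r < π t := by
    by_contra hin
    exact hcon ⟨by omega, by omega, rfl⟩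
  have := π.injective (hπ _ hout)
  omega

theorem Rearranged.injOn (h : Rearranged l r A B) (hA : Set.InjOn A (Set.Icc l r)) :
    Set.InjOn B (Set.Icc l r) := by
  obtain ⟨π, hπ, rfl⟩ := h
  have hmem : ∀ t ∈ Set.Icc l r, π t ∈ Set.Icc l r := by
    intro t ht
    by_contra hout
    have := π.injective (hπ (π t) (by simp only [Set.mem_Icc] at hout; omega))
    rw [this] at hout
    exact hout ht
  exact fun t ht u hu htu => π.injective (hA (hmem t ht) (hmem u hu) htu)

variable [LinearOrder α]

theorem step_rearranged (p q : α) (s : State α) (hij : s.i ≤ s.j) (hjk : s.j ≤ s.k) :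
    Rearranged s.i s.k s.A (step p q s).A := by
  unfold step
  split_ifs
  all_goals first
    | exact Rearranged.refl _
    | exact Rearranged.swapAt _ (by omega) (by omega)
    | exact Rearranged.rotate3 _ le_rfl hij hjk le_rfl

theorem loop_rearranged (p q : α) (s : State α) (hij : s.i ≤ s.j) :
    Rearranged s.i s.k s.A (loop p q s).A := by
  induction s using loop.induct (p := p) (q := q) with
  | case1 s hjk ih =>
    have hb := step_bounds p q s hij
    rw [loop, if_pos hjk]
    exact (step_rearranged p q s hij hjk).trans ((ih hb.2.1).mono hb.1 hb.2.2)
  | case2 s hjk =>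
    rw [loop, if_neg hjk]
    exact Rearranged.refl _

theorem afterLoop_rearranged (A : ℤ → α) (l r : ℤ) :
    Rearranged (l + 1) (r - 1) A (afterLoop A l r).A :=
  loop_rearranged _ _ ⟨A, l + 1, l + 1, r - 1, 0, 0⟩ le_rfl

/-- The loop leaves the two outer entries in place, so overwriting with `p` and `q` loses nothing:
it amounts to ordering the outer entries and then exchanging each with its target position. -/
theorem partitioned_eq (A : ℤ → α) {l r : ℤ} (hlr : l < r) :
    partitioned A l r =
      swapAt (swapAt (if A r < A l then swapAt (afterLoop A l r).A l r else (afterLoop A l r).A)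
        l ((afterLoop A l r).i - 1)) r ((afterLoop A l r).k + 1) := by
  have hb := afterLoop_bounds A hlr
  have hl := afterLoop_outside A (l := l) (r := r) (t := l) (by omega)
  have hr := afterLoop_outside A (l := l) (r := r) (t := r) (by omega)
  have h₁ : (afterLoop A l r).i - 1 ≠ r := by omega
  have h₂ : (afterLoop A l r).k + 1 ≠ l := by omega
  have h₃ : (afterLoop A l r).k + 1 ≠ (afterLoop A l r).i - 1 := by omega
  have h₄ : l ≠ r := by omega
  funext t
  unfold partitioned placePivots pivotP pivotQ swapAt
  generalize afterLoop A l r = s at *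
  generalize s.i - 1 = x at *
  generalize s.k + 1 = y at *
  by_cases h : A r < A l
  · simp only [h, if_true, Function.update_apply]
    split_ifs <;> simp_all
  · simp only [h, if_false, Function.update_apply]
    split_ifs <;> simp_all

theorem partitioned_rearranged (A : ℤ → α) {l r : ℤ} (hlr : l < r) :
    Rearranged l r A (partitioned A l r) := by
  have hb := afterLoop_bounds A hlr
  have h₁ := (afterLoop_rearranged A l r).mono (l' := l) (r' := r) (by omega) (by omega)
  rw [partitioned_eq A hlr]
  refine (Rearranged.trans (B := if A r < A l then swapAt (afterLoop A l r).A l r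
    else (afterLoop A l r).A) ?_ (Rearranged.swapAt _ (by omega) (by omega))).trans
    (Rearranged.swapAt _ (by omega) (by omega))
  split_ifs
  · exact h₁.trans (Rearranged.swapAt _ (by omega) (by omega))
  · exact h₁

end Rearrangement

/-! ### The loop invariant and the classes after partitioning -/

section Invariant

variable {α : Type*} [LinearOrder α]

/-- The classification of the entries in `l, …, r` during the loop: the positions before `i` hold
small elements, those in `i, …, j - 1` medium ones and those after `k` large ones. -/
structure Classified (p q : α) (l r : ℤ) (s : State α) : Prop where
  small : ∀ t, l ≤ t → t < s.i → s.A t < p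
  medium : ∀ t, s.i ≤ t → t < s.j → p ≤ s.A t ∧ s.A t < q
  large : ∀ t, s.k < t → t ≤ r → q ≤ s.A t
  unread : ∀ t, s.j ≤ t → t ≤ s.k → s.A t ≠ q

/-- The clause that unread entries differ from `q` is what makes the test `q < A[k]`, used for
negative `d`, complementary to `A[k] < q`; without it a failed test would not show the element to be
below `q`. -/
theorem Classified.step {p q : α} {l r : ℤ} {s : State α} (h : Classified p q l r s)
    (hij : s.i ≤ s.j) (hjk : s.j ≤ s.k) :
    Classified p q l r (step p q s) := by
  have hj := h.unread s.j le_rfl hjk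
  have hk := h.unread s.k hjk le_rfl
  have key : ∀ (A : ℤ → α) (x y t : ℤ), swapAt A x y t =
      if t = y then A x else if t = x then A y else A t := fun A x y t => by
    simp only [swapAt, Function.update_apply]
  have key' : ∀ (A : ℤ → α) (x y z t : ℤ), x ≤ y → y ≤ z → DualPivotCount.rotate3 A z y x t =
      if t = x then A z else if t = y then A x else if t = z then A y else A t := by
    intro A x y z t hxy hyz
    simp only [DualPivotCount.rotate3, Function.update_apply]
    split_ifs <;> first | rfl | (congr 1; omega)
  obtain ⟨hs, hm, hl, hu⟩ := h
  unfold DualPivotCount.step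
  split_ifs with h₁ h₂ h₃ h₄ h₅
  all_goals refine ⟨fun t ht₁ ht₂ => ?_, fun t ht₁ ht₂ => ?_, fun t ht₁ ht₂ => ?_, fun t ht₁ ht₂ => ?_⟩
  all_goals simp only [key, key' _ _ _ _ _ hij hjk] at ht₁ ht₂ ⊢
  all_goals grind

theorem Classified.loop {p q : α} {l r : ℤ} {s : State α} (h : Classified p q l r s)
    (hij : s.i ≤ s.j) : Classified p q l r (loop p q s) := by
  induction s using loop.induct (p := p) (q := q) with
  | case1 s hjk ih =>
    have hb := step_bounds p q s hij
    rw [DualPivotCount.loop, if_pos hjk]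
    exact ih (h.step hij hjk) hb.2.1
  | case2 s hjk => rwa [DualPivotCount.loop, if_neg hjk]

theorem loop_exit (p q : α) (s : State α) (hjk : s.j ≤ s.k + 1) :
    (loop p q s).j = (loop p q s).k + 1 := by
  induction s using loop.induct (p := p) (q := q) with
  | case1 s h ih =>
    have := step_gap p q s
    rw [loop, if_pos h]
    exact ih (by omega)
  | case2 s h =>
    rw [loop, if_neg h]
    omega

/-- The five classes of positions after partitioning. -/
theorem partitioned_classes {A : ℤ → α} {l r : ℤ} (hlr : l < r) (hA : Set.InjOn A (Set.Icc l r)) :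
    let p := pivotP A l r
    let q := pivotQ A l r
    let i := (afterLoop A l r).i
    let k := (afterLoop A l r).k
    let B := partitioned A l r
    (∀ t, l ≤ t → t < i - 1 → B t < p) ∧ B (i - 1) = p ∧ (∀ t, i ≤ t → t ≤ k → p ≤ B t ∧ B t < q) ∧
      B (k + 1) = q ∧ (∀ t, k + 1 < t → t ≤ r → q ≤ B t) := by
  have hb := afterLoop_bounds A hlr
  have hl : l ∈ Set.Icc l r := ⟨le_rfl, hlr.le⟩
  have hr : r ∈ Set.Icc l r := ⟨hlr.le, le_rfl⟩
  -- The pivot sits at one end of the range and the entries are distinct.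
  have hunread : ∀ t, l + 1 ≤ t → t ≤ r - 1 → A t ≠ pivotQ A l r := by
    intro t h₁ h₂ h
    have ht : t ∈ Set.Icc l r := ⟨by omega, by omega⟩
    unfold pivotQ at h
    split_ifs at h
    · have := hA ht hl h
      omega
    · have := hA ht hr h
      omega
  have hc₀ : Classified (pivotP A l r) (pivotQ A l r) (l + 1) (r - 1)
      ⟨A, l + 1, l + 1, r - 1, 0, 0⟩ :=
    ⟨fun t h₁ h₂ => by simp only at h₂; omega, fun t h₁ h₂ => by simp only at h₁ h₂; omega,
      fun t h₁ h₂ => by simp only at h₁; omega, hunread⟩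
  have hc : Classified _ _ _ _ (afterLoop A l r) := hc₀.loop le_rfl
  have hexit : (afterLoop A l r).j = (afterLoop A l r).k + 1 :=
    loop_exit _ _ _ (by simp only; omega)
  obtain ⟨hs, hm, hg, -⟩ := hc
  intro p q i k B
  have hval : ∀ t, B t = if t = k + 1 then q else if t = r then (afterLoop A l r).A (k + 1) else
      if t = i - 1 then p else if t = l then (afterLoop A l r).A (i - 1)
      else (afterLoop A l r).A t := by
    intro t
    -- `placePivots` reads position `k + 1` only after writing to `l` and `i - 1`; since these
    -- positions differ from `k + 1`, the value read is still the one the loop left there.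
    have : k + 1 ≠ i - 1 := by omega
    have : k + 1 ≠ l := by omega
    simp only [B, partitioned, placePivots, Function.update_apply]
    split_ifs <;> simp_all [i, k, p, q]
  refine ⟨fun t h₁ h₂ => ?_, ?_, fun t h₁ h₂ => ?_, ?_, fun t h₁ h₂ => ?_⟩
  all_goals rw [hval]
  · rw [if_neg (by omega), if_neg (by omega), if_neg (by omega)]
    split_ifs
    · exact hs _ (by omega) (by omega)
    · exact hs _ (by omega) (by omega)
  · rw [if_neg (by omega), if_neg (by omega), if_pos rfl]
  · rw [if_neg (by omega), if_neg (by omega), if_neg (by omega), if_neg (by omega)]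
    exact hm _ h₁ (by omega)
  · rw [if_pos rfl]
  · rw [if_neg (by omega)]
    split_ifs
    · exact hg _ (by omega) (by omega)
    · omega
    · omega
    · exact hg _ (by omega) (by omega)

end Invariant

/-! ### The first stage on a permutation: pivots land at their ranks -/

section Permutation

/-- An injection of `{0, …, n - 1}` into itself is onto, so exactly `p` positions carry values below
`p`; here these are the first `m` positions. It identifies the final position of a pivot with its
rank. -/
theorem eq_of_lt_iff_lt {n p : ℕ} {m : ℤ} {f : ℤ → ℕ} (hf : Set.InjOn f (Set.Icc 0 ((n : ℤ) - 1)))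
    (hlt : ∀ t, 0 ≤ t → t ≤ (n : ℤ) - 1 → f t < n) (hm : 0 ≤ m) (hmn : m ≤ n) (hp : p ≤ n)
    (h : ∀ t, 0 ≤ t → t ≤ (n : ℤ) - 1 → (f t < p ↔ t < m)) : m = p := by
  lift m to ℕ using hm
  have hinj : Set.InjOn (fun t : ℕ => f t) (Finset.range n) := by
    intro a ha b hb hab
    have ha' := Finset.mem_range.mp ha
    have hb' := Finset.mem_range.mp hb
    have := hf (x₁ := (a : ℤ)) (x₂ := (b : ℤ)) ⟨by omega, by omega⟩ ⟨by omega, by omega⟩ hab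
    omega
  have himg : (Finset.range n).image (fun t : ℕ => f t) = Finset.range n := by
    refine Finset.eq_of_subset_of_card_le ?_ (by rw [Finset.card_image_of_injOn hinj])
    intro v hv
    obtain ⟨t, ht, rfl⟩ := Finset.mem_image.mp hv
    have := Finset.mem_range.mp ht
    exact Finset.mem_range.mpr (hlt t (by omega) (by omega))
  have himg' : (Finset.range m).image (fun t : ℕ => f t) = Finset.range p := by
    ext v
    simp only [Finset.mem_image, Finset.mem_range]
    constructor
    · rintro ⟨t, ht, rfl⟩
      exact (h t (by omega) (by omega)).mpr (by omega)
    · intro hv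
      have : v ∈ (Finset.range n).image (fun t : ℕ => f t) := by
        rw [himg]
        exact Finset.mem_range.mpr (by omega)
      obtain ⟨t, ht, rfl⟩ := Finset.mem_image.mp this
      have := Finset.mem_range.mp ht
      exact ⟨t, by have := (h t (by omega) (by omega)).mp hv; omega, rfl⟩
  have := congrArg Finset.card himg'
  rw [Finset.card_image_of_injOn (hinj.mono ?_)] at this
  · simpa using this
  · intro a ha
    have := Finset.mem_range.mp ha
    exact Finset.mem_coe.mpr (Finset.mem_range.mpr (by omega))

theorem inputArray_coe {n : ℕ} (σ : Equiv.Perm (Fin n)) (t : Fin n) :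
    inputArray σ (t : ℤ) = σ t := by
  simp [inputArray]

theorem exists_fin_of_mem {n : ℕ} {t : ℤ} (h₁ : 0 ≤ t) (h₂ : t ≤ (n : ℤ) - 1) :
    ∃ u : Fin n, t = u :=
  ⟨⟨t.toNat, by omega⟩, by simp only; omega⟩

theorem inputArray_lt {n : ℕ} (σ : Equiv.Perm (Fin n)) (t : ℤ) (h₁ : 0 ≤ t)
    (h₂ : t ≤ (n : ℤ) - 1) : inputArray σ t < n := by
  obtain ⟨u, rfl⟩ := exists_fin_of_mem h₁ h₂
  rw [inputArray_coe]
  exact (σ u).2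

theorem inputArray_injOn {n : ℕ} (σ : Equiv.Perm (Fin n)) :
    Set.InjOn (inputArray σ) (Set.Icc 0 ((n : ℤ) - 1)) := by
  intro a ha b hb hab
  obtain ⟨u, rfl⟩ := exists_fin_of_mem ha.1 ha.2
  obtain ⟨v, rfl⟩ := exists_fin_of_mem hb.1 hb.2
  rw [inputArray_coe, inputArray_coe] at hab
  rw [σ.injective (Fin.ext hab)]

variable {N : ℕ}

/-- The rank of the smaller pivot. -/
def lowPivot (σ : Equiv.Perm (Fin (N + 2))) : ℕ := min (σ 0 : ℕ) (σ (Fin.last _))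

/-- The rank of the larger pivot. -/
def highPivot (σ : Equiv.Perm (Fin (N + 2))) : ℕ := max (σ 0 : ℕ) (σ (Fin.last _))

variable (σ : Equiv.Perm (Fin (N + 2)))

theorem inputArray_zero : inputArray σ 0 = σ 0 := inputArray_coe σ 0

theorem inputArray_last : inputArray σ (((N + 2 : ℕ) : ℤ) - 1) = σ (Fin.last _) := by
  rw [← inputArray_coe σ (Fin.last _)]
  congr 1
  simp
  ring

theorem pivotP_inputArray :
    pivotP (inputArray σ) 0 (((N + 2 : ℕ) : ℤ) - 1) = lowPivot σ := by
  rw [pivotP, inputArray_zero, inputArray_last, lowPivot]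
  split_ifs <;> omega

theorem pivotQ_inputArray :
    pivotQ (inputArray σ) 0 (((N + 2 : ℕ) : ℤ) - 1) = highPivot σ := by
  rw [pivotQ, inputArray_zero, inputArray_last, highPivot]
  split_ifs <;> omega

theorem lowPivot_lt_highPivot : lowPivot σ < highPivot σ := by
  have h : σ 0 ≠ σ (Fin.last _) := fun h => absurd (σ.injective h) (by simp [Fin.ext_iff])
  have : (σ 0 : ℕ) ≠ σ (Fin.last _) := fun h' => h (Fin.ext h')
  unfold lowPivot highPivot
  omega

theorem highPivot_lt : highPivot σ < N + 2 := by
  have h₁ := (σ 0).2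
  have h₂ := (σ (Fin.last _)).2
  unfold highPivot
  omega

/-- The array after the first partitioning stage. -/
def splitArray : ℤ → ℕ := partitioned (inputArray σ) 0 (((N + 2 : ℕ) : ℤ) - 1)

theorem splitArray_injOn : Set.InjOn (splitArray σ) (Set.Icc 0 (((N + 2 : ℕ) : ℤ) - 1)) :=
  (partitioned_rearranged _ (by omega)).injOn (inputArray_injOn σ)

theorem splitArray_lt (t : ℤ) (h₁ : 0 ≤ t) (h₂ : t ≤ ((N + 2 : ℕ) : ℤ) - 1) :
    splitArray σ t < N + 2 := by
  obtain ⟨u, hu, hu', he⟩ := (partitioned_rearranged (inputArray σ)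
    (l := 0) (r := ((N + 2 : ℕ) : ℤ) - 1) (by omega)).exists_index h₁ h₂
  rw [splitArray, he]
  exact inputArray_lt σ u hu hu'

theorem afterLoop_i_eq :
    (afterLoop (inputArray σ) 0 (((N + 2 : ℕ) : ℤ) - 1)).i = lowPivot σ + 1 := by
  have hlt := lowPivot_lt_highPivot σ
  have hlt' := highPivot_lt σ
  obtain ⟨h₁, h₂, h₃, h₄, h₅⟩ := partitioned_classes (l := 0) (r := ((N + 2 : ℕ) : ℤ) - 1)
    (by omega) (inputArray_injOn σ)
  have hb := afterLoop_bounds (inputArray σ) (left := 0) (right := ((N + 2 : ℕ) : ℤ) - 1) (by omega)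
  rw [pivotP_inputArray] at h₁ h₂ h₃
  rw [pivotQ_inputArray] at h₃ h₄ h₅
  have := eq_of_lt_iff_lt (p := lowPivot σ) (splitArray_injOn σ) (splitArray_lt σ)
    (m := (afterLoop (inputArray σ) 0 (((N + 2 : ℕ) : ℤ) - 1)).i - 1) (by omega) (by omega)
    (by omega) ?_
  · omega
  · intro t ht₁ ht₂
    unfold splitArray
    generalize afterLoop (inputArray σ) 0 (((N + 2 : ℕ) : ℤ) - 1) = s at *
    refine ⟨fun h => ?_, h₁ t ht₁⟩
    by_contra hcon
    rcases eq_or_ne t (s.i - 1) with rfl | hti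
    · omega
    rcases le_or_gt t s.k with htk | htk
    · have := h₃ t (by omega) htk
      omega
    rcases eq_or_ne t (s.k + 1) with rfl | htk'
    · omega
    · have := h₅ t (by omega) ht₂
      omega

theorem afterLoop_k_eq :
    (afterLoop (inputArray σ) 0 (((N + 2 : ℕ) : ℤ) - 1)).k = highPivot σ - 1 := by
  have hlt := lowPivot_lt_highPivot σ
  have hlt' := highPivot_lt σ
  obtain ⟨h₁, h₂, h₃, h₄, h₅⟩ := partitioned_classes (l := 0) (r := ((N + 2 : ℕ) : ℤ) - 1)
    (by omega) (inputArray_injOn σ)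
  have hb := afterLoop_bounds (inputArray σ) (left := 0) (right := ((N + 2 : ℕ) : ℤ) - 1) (by omega)
  rw [pivotP_inputArray] at h₁ h₂ h₃
  rw [pivotQ_inputArray] at h₃ h₄ h₅
  have := eq_of_lt_iff_lt (p := highPivot σ) (splitArray_injOn σ) (splitArray_lt σ)
    (m := (afterLoop (inputArray σ) 0 (((N + 2 : ℕ) : ℤ) - 1)).k + 1) (by omega) (by omega)
    (by omega) ?_
  · omega
  · intro t ht₁ ht₂
    unfold splitArray
    generalize afterLoop (inputArray σ) 0 (((N + 2 : ℕ) : ℤ) - 1) = s at *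
    constructor
    · intro h
      by_contra hcon
      rcases eq_or_ne t (s.k + 1) with rfl | htk'
      · omega
      · have := h₅ t (by omega) ht₂
        omega
    · intro h
      rcases lt_trichotomy t (s.i - 1) with hti | rfl | hti
      · have := h₁ t ht₁ hti
        omega
      · omega
      · exact (h₃ t (by omega) (by omega)).2

theorem splitArray_low : splitArray σ (lowPivot σ) = lowPivot σ := by
  have h := (partitioned_classes (l := 0) (r := ((N + 2 : ℕ) : ℤ) - 1)
    (by omega) (inputArray_injOn σ)).2.1
  rw [pivotP_inputArray, afterLoop_i_eq] at h
  rwa [show ((lowPivot σ : ℤ) + 1 - 1) = lowPivot σ by ring] at h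

theorem splitArray_high : splitArray σ (highPivot σ) = highPivot σ := by
  have h := (partitioned_classes (l := 0) (r := ((N + 2 : ℕ) : ℤ) - 1)
    (by omega) (inputArray_injOn σ)).2.2.2.1
  rw [pivotQ_inputArray, afterLoop_k_eq] at h
  rwa [show ((highPivot σ : ℤ) - 1 + 1) = highPivot σ by ring] at h

theorem splitArray_small {t : ℤ} (h₁ : 0 ≤ t) (h₂ : t < lowPivot σ) :
    splitArray σ t < lowPivot σ := by
  have h := (partitioned_classes (l := 0) (r := ((N + 2 : ℕ) : ℤ) - 1)
    (by omega) (inputArray_injOn σ)).1 t h₁ (by rw [afterLoop_i_eq]; omega)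
  rwa [pivotP_inputArray] at h

theorem splitArray_medium {t : ℤ} (h₁ : lowPivot σ < t) (h₂ : t < highPivot σ) :
    lowPivot σ < splitArray σ t ∧ splitArray σ t < highPivot σ := by
  have hlt := highPivot_lt σ
  have h := (partitioned_classes (l := 0) (r := ((N + 2 : ℕ) : ℤ) - 1)
    (by omega) (inputArray_injOn σ)).2.2.1 t (by rw [afterLoop_i_eq]; omega)
    (by rw [afterLoop_k_eq]; omega)
  rw [pivotP_inputArray, pivotQ_inputArray] at h
  refine ⟨lt_of_le_of_ne h.1 fun he => ?_, h.2⟩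
  have := splitArray_injOn σ (x₁ := (lowPivot σ : ℤ)) (x₂ := t) ⟨by omega, by omega⟩
    ⟨by omega, by omega⟩ ((splitArray_low σ).trans he)
  omega

theorem splitArray_large {t : ℤ} (h₁ : highPivot σ < t) (h₂ : t ≤ ((N + 2 : ℕ) : ℤ) - 1) :
    highPivot σ < splitArray σ t := by
  have h := (partitioned_classes (l := 0) (r := ((N + 2 : ℕ) : ℤ) - 1)
    (by omega) (inputArray_injOn σ)).2.2.2.2 t (by rw [afterLoop_k_eq]; omega) h₂
  rw [pivotQ_inputArray] at h
  refine lt_of_le_of_ne h fun he => ?_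
  have := splitArray_injOn σ (x₁ := (highPivot σ : ℤ)) (x₂ := t) ⟨by omega, by omega⟩
    ⟨by omega, by omega⟩ ((splitArray_high σ).trans he)
  omega

/-- The number of swaps executed by the first partitioning loop. -/
def loopSwaps : ℚ := (afterLoop (inputArray σ) 0 (((N + 2 : ℕ) : ℤ) - 1)).swaps

/-- The number of swaps when sorting the `m` positions of the array `A` from `u` on. -/
def segmentSwaps (A : ℤ → ℕ) (u m : ℕ) : ℚ := (count A u ((u : ℤ) + m - 1)).2

/-- The later calls run on arrays modified by the earlier ones, but the three ranges are disjoint,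
so each call finds its part of the partitioned array intact. -/
theorem swapCount_eq :
    swapCount σ = loopSwaps σ + 2 + segmentSwaps (splitArray σ) 0 (lowPivot σ) +
      segmentSwaps (splitArray σ) (lowPivot σ + 1) (highPivot σ - lowPivot σ - 1) +
      segmentSwaps (splitArray σ) (highPivot σ + 1) (N + 1 - highPivot σ) := by
  have hlt := lowPivot_lt_highPivot σ
  have hlt' := highPivot_lt σ
  rw [swapCount, count_of_lt _ (by omega)]
  simp only [afterLoop_i_eq, afterLoop_k_eq]
  change _ + 2 + _ + _ + _ = _
  unfold segmentSwaps
  congr 1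
  · congr 1
    · congr 1
      congr 2
      push_cast
      ring
    · rw [count_congr (A := splitArray σ)]
      · (congr 2; omega)
      · intro t h₁ h₂
        rw [count_outside _ _ _ (by omega)]
        rfl
  · rw [count_congr (A := splitArray σ)]
    · congr 2 <;> omega
    · intro t h₁ h₂
      rw [count_outside _ _ _ (by omega), count_outside _ _ _ (by omega)]
      rfl

end Permutation

/-! ### Randomness is preserved in the three segments -/

section Segment

/-- The expected number of swaps, as a rational number. -/
def meanSwaps (n : ℕ) : ℚ := (∑ σ : Equiv.Perm (Fin n), swapCount σ) / n.factorial

variable {N : ℕ}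

/-- The embedding of `m` elements as the values `u, …, u + m - 1`. -/
def shiftEmbedding {n u m : ℕ} (h : u + m ≤ n) : Fin m ↪ Fin n where
  toFun x := ⟨u + x, by omega⟩
  inj' x y hxy := by
    have := congrArg Fin.val hxy
    exact Fin.ext (by simpa using this)

/-- Extend a permutation `ρ` of `m` elements to act on the values `u, …, u + m - 1`. -/
noncomputable def shiftPerm {n u m : ℕ} (h : u + m ≤ n) (ρ : Equiv.Perm (Fin m)) :
    Equiv.Perm (Fin n) :=
  ρ.viaEmbedding (shiftEmbedding h)

/-- The action of `shiftPerm` on natural numbers. -/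
def shiftFun (u : ℕ) {m : ℕ} (ρ : Equiv.Perm (Fin m)) (v : ℕ) : ℕ :=
  if h : u ≤ v ∧ v < u + m then u + ρ ⟨v - u, by omega⟩ else v

theorem shiftPerm_val {n u m : ℕ} (h : u + m ≤ n) (ρ : Equiv.Perm (Fin m)) (v : Fin n) :
    (shiftPerm h ρ v : ℕ) = shiftFun u ρ v := by
  unfold shiftPerm shiftFun
  split_ifs with hv
  · have : v = shiftEmbedding h ⟨v - u, by omega⟩ :=
      Fin.ext (show (v : ℕ) = u + (v - u) by omega)
    conv_lhs => rw [this, Equiv.Perm.viaEmbedding_apply]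
    rfl
  · rw [Equiv.Perm.viaEmbedding_apply_of_notMem]
    rintro ⟨x, rfl⟩
    have : (shiftEmbedding h x : ℕ) = u + x := rfl
    omega

theorem shiftFun_add {u m : ℕ} (ρ : Equiv.Perm (Fin m)) (x : Fin m) :
    shiftFun u ρ (u + x) = u + ρ x := by
  rw [shiftFun, dif_pos (by omega)]
  simp

theorem shiftFun_mem {u m : ℕ} (ρ : Equiv.Perm (Fin m)) {v : ℕ} (h : u ≤ v) (h' : v < u + m) :
    u ≤ shiftFun u ρ v ∧ shiftFun u ρ v < u + m := by
  rw [shiftFun, dif_pos ⟨h, h'⟩]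
  omega

theorem inputArray_shiftPerm {n u m : ℕ} (h : u + m ≤ n) (ρ : Equiv.Perm (Fin m))
    (σ : Equiv.Perm (Fin n)) {t : ℤ} (h₁ : 0 ≤ t) (h₂ : t ≤ (n : ℤ) - 1) :
    inputArray (shiftPerm h ρ * σ) t = shiftFun u ρ (inputArray σ t) := by
  obtain ⟨x, rfl⟩ := exists_fin_of_mem h₁ h₂
  rw [inputArray_coe, inputArray_coe, Equiv.Perm.mul_apply, shiftPerm_val]

/-- The block of values `u, …, u + m - 1` contains neither `p` nor `q`. -/
def Avoids (u m p q : ℕ) : Prop := u + m ≤ p ∨ (p < u ∧ u + m ≤ q) ∨ q < u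

section Pivots

variable {u m : ℕ} (ρ : Equiv.Perm (Fin m))

theorem shiftFun_lt_iff_of_outside {a : ℕ} (ha : u + m ≤ a ∨ a < u) (x : ℕ) :
    shiftFun u ρ x < a ↔ x < a := by
  by_cases hx : u ≤ x ∧ x < u + m
  · have := shiftFun_mem ρ hx.1 hx.2
    omega
  · rw [shiftFun, dif_neg hx]

theorem lt_shiftFun_iff_of_outside {a : ℕ} (ha : u + m ≤ a ∨ a < u) (x : ℕ) :
    a < shiftFun u ρ x ↔ a < x := by
  by_cases hx : u ≤ x ∧ x < u + m
  · have := shiftFun_mem ρ hx.1 hx.2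
    omega
  · rw [shiftFun, dif_neg hx]

theorem shiftFun_of_outside {a : ℕ} (ha : u + m ≤ a ∨ a < u) : shiftFun u ρ a = a :=
  dif_neg (by omega)

variable (h : u + m ≤ N + 2) (σ : Equiv.Perm (Fin (N + 2)))

theorem shiftPerm_ends
    (hav : Avoids u m (lowPivot σ) (highPivot σ)) :
    ((shiftPerm h ρ * σ) 0 : ℕ) = σ 0 ∧ ((shiftPerm h ρ * σ) (Fin.last _) : ℕ) = σ (Fin.last _) := by
  simp only [Equiv.Perm.mul_apply, shiftPerm_val]
  unfold Avoids lowPivot highPivot at hav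
  exact ⟨shiftFun_of_outside ρ (by omega), shiftFun_of_outside ρ (by omega)⟩

theorem lowPivot_shiftPerm
    (hav : Avoids u m (lowPivot σ) (highPivot σ)) :
    lowPivot (shiftPerm h ρ * σ) = lowPivot σ := by
  obtain ⟨h₁, h₂⟩ := shiftPerm_ends ρ h σ hav
  rw [lowPivot, h₁, h₂, lowPivot]

theorem highPivot_shiftPerm
    (hav : Avoids u m (lowPivot σ) (highPivot σ)) :
    highPivot (shiftPerm h ρ * σ) = highPivot σ := by
  obtain ⟨h₁, h₂⟩ := shiftPerm_ends ρ h σ hav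
  rw [highPivot, h₁, h₂, highPivot]

/-- The block contains no pivot, so permuting its values keeps every comparison with a pivot. The
first stage therefore makes the same moves, and its output changes by the same relabelling of
values. -/
theorem splitArray_shiftPerm
    (hav : Avoids u m (lowPivot σ) (highPivot σ))
    {t : ℤ} (h₁ : 0 ≤ t) (h₂ : t ≤ ((N + 2 : ℕ) : ℤ) - 1) :
    splitArray (shiftPerm h ρ * σ) t = shiftFun u ρ (splitArray σ t) := by
  have hp : u + m ≤ lowPivot σ ∨ lowPivot σ < u := by
    have := lowPivot_lt_highPivot σ
    unfold Avoids at hav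
    omega
  have hq : u + m ≤ highPivot σ ∨ highPivot σ < u := by
    have := lowPivot_lt_highPivot σ
    unfold Avoids at hav
    omega
  have hR : Related (shiftFun u ρ) 0 0 (((N + 2 : ℕ) : ℤ) - 1) Set.univ (inputArray σ)
      (inputArray (shiftPerm h ρ * σ)) := fun t h₁ h₂ =>
    ⟨trivial, by rw [add_zero, inputArray_shiftPerm h ρ σ h₁ h₂]⟩
  have := (partitioned_related (by omega) hR
    (by rw [zero_add, add_zero, pivotP_inputArray, pivotP_inputArray, lowPivot_shiftPerm ρ h σ hav,
      shiftFun_of_outside ρ hp])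
    (by rw [zero_add, add_zero, pivotQ_inputArray, pivotQ_inputArray, highPivot_shiftPerm ρ h σ hav,
      shiftFun_of_outside ρ hq])
    (fun x _ => by
      rw [pivotP_inputArray, shiftFun_of_outside ρ hp, shiftFun_lt_iff_of_outside ρ hp])
    (fun x _ => by
      rw [pivotQ_inputArray, shiftFun_of_outside ρ hq, shiftFun_lt_iff_of_outside ρ hq])
    (fun x _ => by
      rw [pivotQ_inputArray, shiftFun_of_outside ρ hq, lt_shiftFun_iff_of_outside ρ hq])).2.2.2
    t h₁ h₂
  rw [zero_add, add_zero, add_zero] at this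
  exact this.2

end Pivots

theorem splitArray_block (σ : Equiv.Perm (Fin (N + 2))) {u m : ℕ}
    (hblock : (u = 0 ∧ m = lowPivot σ) ∨
      (u = lowPivot σ + 1 ∧ m = highPivot σ - lowPivot σ - 1) ∨
      (u = highPivot σ + 1 ∧ m = N + 1 - highPivot σ)) (x : Fin m) :
    u ≤ splitArray σ ((u : ℤ) + x) ∧ splitArray σ ((u : ℤ) + x) < u + m := by
  have hlt := lowPivot_lt_highPivot σ
  have hlt' := highPivot_lt σ
  have hx := x.2
  rcases hblock with ⟨hu, hm⟩ | ⟨hu, hm⟩ | ⟨hu, hm⟩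
  · have := splitArray_small σ (t := (u : ℤ) + x) (by omega) (by omega)
    omega
  · have := splitArray_medium σ (t := (u : ℤ) + x) (by omega) (by omega)
    omega
  · have := splitArray_large σ (t := (u : ℤ) + x) (by omega) (by omega)
    have := splitArray_lt σ ((u : ℤ) + x) (by omega) (by omega)
    omega

/-- Averaging over all rearrangements of the values in one block gives the expected number of swaps
for its length. -/
theorem sum_segmentSwaps_shiftPerm (σ : Equiv.Perm (Fin (N + 2))) {u m : ℕ} (h : u + m ≤ N + 2)
    (hblock : (u = 0 ∧ m = lowPivot σ) ∨
      (u = lowPivot σ + 1 ∧ m = highPivot σ - lowPivot σ - 1) ∨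
      (u = highPivot σ + 1 ∧ m = N + 1 - highPivot σ)) :
    ∑ ρ : Equiv.Perm (Fin m), segmentSwaps (splitArray (shiftPerm h ρ * σ)) u m =
      m.factorial * meanSwaps m := by
  have hlt := lowPivot_lt_highPivot σ
  have hlt' := highPivot_lt σ
  have hav : Avoids u m (lowPivot σ) (highPivot σ) := by
    unfold Avoids
    omega
  have hb := splitArray_block σ hblock
  -- The segment at positions `u, …, u + m - 1` holds the values of that same interval, so
  -- subtracting `u` turns it into a permutation `κ` of `m` elements. Relabelling by `ρ` turns `κ`
  -- into `ρ * κ`, which runs over all permutations as `ρ` does.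
  let f : Fin m → Fin m := fun x => ⟨splitArray σ ((u : ℤ) + x) - u, by have := hb x; omega⟩
  have hf : Function.Injective f := by
    intro x y hxy
    have h₁ := hb x
    have h₂ := hb y
    have h₃ : splitArray σ ((u : ℤ) + x) - u = splitArray σ ((u : ℤ) + y) - u :=
      congrArg Fin.val hxy
    have := splitArray_injOn σ (x₁ := (u : ℤ) + x) (x₂ := (u : ℤ) + y) ⟨by omega, by omega⟩
      ⟨by omega, by omega⟩ (by omega)
    exact Fin.ext (by omega)
  let κ : Equiv.Perm (Fin m) := Equiv.ofBijective f (Finite.injective_iff_bijective.mp hf)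
  have key : ∀ ρ : Equiv.Perm (Fin m),
      segmentSwaps (splitArray (shiftPerm h ρ * σ)) u m = swapCount (ρ * κ) := by
    intro ρ
    have hR : Related (fun v : ℕ => u + v) (u : ℤ) 0 ((m : ℤ) - 1) Set.univ (inputArray (ρ * κ))
        (splitArray (shiftPerm h ρ * σ)) := by
      intro t h₁ h₂
      refine ⟨trivial, ?_⟩
      rw [splitArray_shiftPerm ρ h σ hav (by omega) (by omega)]
      obtain ⟨x, rfl⟩ := exists_fin_of_mem h₁ h₂
      have hbx := hb x
      have hv : splitArray σ ((x : ℤ) + u) = u + (κ x : ℕ) := by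
        change _ = u + (splitArray σ ((u : ℤ) + x) - u)
        rw [add_comm (x : ℤ)]
        omega
      rw [hv, shiftFun_add, inputArray_coe, Equiv.Perm.mul_apply]
    have := (count_related (fun a _ b _ hab => by simpa using hab) hR).1
    rw [swapCount, segmentSwaps, ← this]
    congr 2
    · ring
    · ring
  simp only [key]
  rw [meanSwaps, mul_div_cancel₀ _ (by exact_mod_cast m.factorial_ne_zero)]
  exact Equiv.sum_comp (Equiv.mulRight κ) swapCount

/-- The permutations are grouped by their pivots, which fixes the block. Relabelling inside the
block maps each group onto itself, so the sum over a group equals its average over all relabellings,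
and `sum_segmentSwaps_shiftPerm` evaluates that average for each `σ` separately. -/
theorem sum_segmentSwaps {u m : ℕ → ℕ → ℕ}
    (hblock : (∀ p q, u p q = 0 ∧ m p q = p) ∨
      (∀ p q, u p q = p + 1 ∧ m p q = q - p - 1) ∨
      (∀ p q, u p q = q + 1 ∧ m p q = N + 1 - q)) :
    ∑ σ : Equiv.Perm (Fin (N + 2)), segmentSwaps (splitArray σ)
        (u (lowPivot σ) (highPivot σ)) (m (lowPivot σ) (highPivot σ)) =
      ∑ σ : Equiv.Perm (Fin (N + 2)), meanSwaps (m (lowPivot σ) (highPivot σ)) := by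
  classical
  have hmaps : ∀ σ ∈ (Finset.univ : Finset (Equiv.Perm (Fin (N + 2)))),
      (lowPivot σ, highPivot σ) ∈ Finset.range (N + 2) ×ˢ Finset.range (N + 2) := by
    intro σ _
    have hlt := lowPivot_lt_highPivot σ
    have hlt' := highPivot_lt σ
    simp only [Finset.mem_product, Finset.mem_range]
    omega
  rw [← Finset.sum_fiberwise_of_maps_to hmaps, ← Finset.sum_fiberwise_of_maps_to hmaps]
  refine Finset.sum_congr rfl fun pq _ => ?_
  obtain ⟨p, q⟩ := pq
  set F := (Finset.univ : Finset (Equiv.Perm (Fin (N + 2)))).filter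
    (fun σ => (lowPivot σ, highPivot σ) = (p, q)) with hF
  have hmem : ∀ σ, σ ∈ F ↔ lowPivot σ = p ∧ highPivot σ = q := by
    intro σ
    simp [hF]
  rcases F.eq_empty_or_nonempty with he | ⟨σ₀, hσ₀⟩
  · rw [he]
    simp
  have hpq : p < q ∧ q < N + 2 := by
    have h₁ := lowPivot_lt_highPivot σ₀
    have h₂ := highPivot_lt σ₀
    rw [((hmem σ₀).mp hσ₀).1, ((hmem σ₀).mp hσ₀).2] at h₁
    rw [((hmem σ₀).mp hσ₀).2] at h₂
    exact ⟨h₁, h₂⟩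
  set u' := u p q with hu'
  set m' := m p q with hm'
  have hb : (u' = 0 ∧ m' = p) ∨ (u' = p + 1 ∧ m' = q - p - 1) ∨ (u' = q + 1 ∧ m' = N + 1 - q) := by
    rcases hblock with h | h | h
    exacts [Or.inl (h p q), Or.inr (Or.inl (h p q)), Or.inr (Or.inr (h p q))]
  have hle : u' + m' ≤ N + 2 := by omega
  have hav : Avoids u' m' p q := by
    unfold Avoids
    omega
  have hleft : ∑ σ ∈ F, segmentSwaps (splitArray σ) (u (lowPivot σ) (highPivot σ))
      (m (lowPivot σ) (highPivot σ)) = ∑ σ ∈ F, segmentSwaps (splitArray σ) u' m' :=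
    Finset.sum_congr rfl fun σ hσ => by rw [((hmem σ).mp hσ).1, ((hmem σ).mp hσ).2]
  have hright : ∑ σ ∈ F, meanSwaps (m (lowPivot σ) (highPivot σ)) = ∑ σ ∈ F, meanSwaps m' :=
    Finset.sum_congr rfl fun σ hσ => by rw [((hmem σ).mp hσ).1, ((hmem σ).mp hσ).2]
  rw [hleft, hright]
  have hfix : ∀ (ρ : Equiv.Perm (Fin m')) σ, σ ∈ F → shiftPerm hle ρ * σ ∈ F := by
    intro ρ σ hσ
    obtain ⟨h₁, h₂⟩ := (hmem σ).mp hσ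
    have hav' : Avoids u' m' (lowPivot σ) (highPivot σ) := by rwa [h₁, h₂]
    rw [hmem, lowPivot_shiftPerm ρ hle σ hav', highPivot_shiftPerm ρ hle σ hav']
    exact ⟨h₁, h₂⟩
  have hshift : ∀ ρ : Equiv.Perm (Fin m'), ∑ σ ∈ F, segmentSwaps (splitArray σ) u' m' =
      ∑ σ ∈ F, segmentSwaps (splitArray (shiftPerm hle ρ * σ)) u' m' := by
    intro ρ
    have himg : F.image (fun σ => shiftPerm hle ρ * σ) = F :=
      Finset.eq_of_subset_of_card_le
        (fun τ hτ => by
          obtain ⟨σ, hσ, rfl⟩ := Finset.mem_image.mp hτ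
          exact hfix ρ σ hσ)
        (by rw [Finset.card_image_of_injective _ (mul_right_injective _)])
    conv_lhs => rw [← himg]
    exact Finset.sum_image (fun a _ b _ hab => mul_right_injective _ hab)
  have hfac : ((m'.factorial : ℕ) : ℚ) ≠ 0 := by exact_mod_cast m'.factorial_ne_zero
  apply mul_left_cancel₀ hfac
  calc (m'.factorial : ℚ) * ∑ σ ∈ F, segmentSwaps (splitArray σ) u' m'
      = ∑ ρ : Equiv.Perm (Fin m'), ∑ σ ∈ F, segmentSwaps (splitArray σ) u' m' := by
        rw [Finset.sum_const, Finset.card_univ, Fintype.card_perm, Fintype.card_fin, nsmul_eq_mul]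
    _ = ∑ ρ : Equiv.Perm (Fin m'), ∑ σ ∈ F,
          segmentSwaps (splitArray (shiftPerm hle ρ * σ)) u' m' :=
        Finset.sum_congr rfl fun ρ _ => hshift ρ
    _ = ∑ σ ∈ F, ∑ ρ : Equiv.Perm (Fin m'),
          segmentSwaps (splitArray (shiftPerm hle ρ * σ)) u' m' := Finset.sum_comm
    _ = ∑ σ ∈ F, (m'.factorial : ℚ) * meanSwaps m' := by
        refine Finset.sum_congr rfl fun σ hσ => sum_segmentSwaps_shiftPerm σ hle ?_
        rw [((hmem σ).mp hσ).1, ((hmem σ).mp hσ).2]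
        exact hb
    _ = _ := by rw [Finset.mul_sum]

theorem sum_swapCount :
    ∑ σ : Equiv.Perm (Fin (N + 2)), swapCount σ =
      ∑ σ : Equiv.Perm (Fin (N + 2)), (loopSwaps σ + 2 + meanSwaps (lowPivot σ) +
        meanSwaps (highPivot σ - lowPivot σ - 1) + meanSwaps (N + 1 - highPivot σ)) := by
  have h₁ := sum_segmentSwaps (N := N) (u := fun _ _ => 0) (m := fun p _ => p)
    (Or.inl fun _ _ => ⟨rfl, rfl⟩)
  have h₂ := sum_segmentSwaps (N := N) (u := fun p _ => p + 1) (m := fun p q => q - p - 1)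
    (Or.inr (Or.inl fun _ _ => ⟨rfl, rfl⟩))
  have h₃ := sum_segmentSwaps (N := N) (u := fun _ q => q + 1) (m := fun _ q => N + 1 - q)
    (Or.inr (Or.inr fun _ _ => ⟨rfl, rfl⟩))
  simp only [swapCount_eq, Finset.sum_add_distrib, h₁, h₂, h₃]

end Segment

/-! ### Words of classes and the irrelevance of the reading order -/

section Words

/-- The three classes of non-pivot elements. -/
inductive Kind
  | small
  | medium
  | large
  deriving DecidableEq

instance : Fintype Kind := ⟨{.small, .medium, .large}, fun x => by cases x <;> decide⟩

theorem sum_kind {M : Type*} [AddCommMonoid M] (f : Kind → M) :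
    ∑ x, f x = f .small + f .medium + f .large := by
  have h : (Finset.univ : Finset Kind) = {.small, .medium, .large} := rfl
  rw [h, Finset.sum_insert (by decide), Finset.sum_insert (by decide), Finset.sum_singleton,
    add_assoc]

/-- The change of the difference `d` caused by reading an element. -/
def Kind.drift : Kind → ℤ
  | .small => 1
  | .medium => 0
  | .large => -1

/-- The number of swaps executed for reading an element. -/
def readCost (d : ℤ) : Kind → ℚ
  | .small => if 0 ≤ d then 1 else 3 / 2
  | .medium => if 0 ≤ d then 0 else 1
  | .large => if 0 ≤ d then 1 else 0

/-- The word `c` with its first and last letters exchanged. -/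
def flipEnds {N : ℕ} (c : Fin (N + 1) → Kind) : Fin (N + 1) → Kind :=
  c ∘ Equiv.swap 0 (Fin.last N)

/-- The letter of the unread part `c` that is read next. -/
def readLetter {N : ℕ} (d : ℤ) (c : Fin (N + 1) → Kind) : Kind :=
  if 0 ≤ d then c 0 else c (Fin.last N)

/-- The unread part after reading a letter. -/
def readRest {N : ℕ} (d : ℤ) (c : Fin (N + 1) → Kind) : Fin N → Kind :=
  if 0 ≤ d then
    if c 0 = .large then Fin.init (flipEnds c) else Fin.tail c
  else
    if c (Fin.last N) = .large then Fin.init c else Fin.tail (flipEnds c)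

/-- The number of swaps executed by the partitioning loop on an unread part `c`. -/
def loopCost : (N : ℕ) → ℤ → (Fin N → Kind) → ℚ
  | 0, _, _ => 0
  | N + 1, d, c =>
    readCost d (readLetter d c) + loopCost N (d + (readLetter d c).drift) (readRest d c)

/-- The cost of reading the letters of `c` from left to right. -/
def scanCost : (N : ℕ) → ℤ → (Fin N → Kind) → ℚ
  | 0, _, _ => 0
  | N + 1, d, c => readCost d (c 0) + scanCost N (d + (c 0).drift) (Fin.tail c)

/-- The word that yields the letter `x` and the rest `w`. -/
def unread {N : ℕ} (d : ℤ) (x : Kind) (w : Fin N → Kind) : Fin (N + 1) → Kind :=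
  if 0 ≤ d then
    if x = .large then flipEnds (Fin.snoc w x) else Fin.cons x w
  else
    if x = .large then Fin.snoc w x else flipEnds (Fin.cons x w)

variable {N : ℕ}

theorem flipEnds_flipEnds (c : Fin (N + 1) → Kind) : flipEnds (flipEnds c) = c := by
  funext t
  simp [flipEnds]

theorem flipEnds_zero (c : Fin (N + 1) → Kind) : flipEnds c 0 = c (Fin.last N) := by
  simp [flipEnds]

theorem flipEnds_last (c : Fin (N + 1) → Kind) : flipEnds c (Fin.last N) = c 0 := by
  simp [flipEnds]

theorem flipEnds_castSucc (c : Fin (N + 1) → Kind) (t : Fin N) :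
    flipEnds c t.castSucc = if (t : ℕ) = 0 then c (Fin.last N) else c t.castSucc := by
  simp only [flipEnds, Function.comp, Equiv.swap_apply_def, Fin.ext_iff, Fin.val_castSucc,
    Fin.val_zero, Fin.val_last, t.2.ne, if_false]
  split_ifs <;> rfl

theorem flipEnds_succ (c : Fin (N + 1) → Kind) (t : Fin N) :
    flipEnds c t.succ = if (t : ℕ) + 1 = N then c 0 else c t.succ := by
  simp only [flipEnds, Function.comp, Equiv.swap_apply_def, Fin.ext_iff, Fin.val_succ,
    Fin.val_zero, Fin.val_last, Nat.succ_ne_zero, if_false]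
  split_ifs <;> rfl

theorem readLetter_unread (d : ℤ) (x : Kind) (w : Fin N → Kind) :
    readLetter d (unread d x w) = x := by
  unfold readLetter unread
  split_ifs <;> simp [flipEnds_zero, flipEnds_last]

theorem readRest_unread (d : ℤ) (x : Kind) (w : Fin N → Kind) :
    readRest d (unread d x w) = w := by
  unfold readRest unread
  by_cases hd : 0 ≤ d <;> by_cases hx : x = .large <;>
    simp [hd, hx, flipEnds_zero, flipEnds_last, flipEnds_flipEnds, Fin.init_snoc, Fin.tail_cons]

/-- The sign of `d` and the letter read together determine which end was dropped and whether the
ends were exchanged before, so the step can be undone. -/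
theorem unread_read (d : ℤ) (c : Fin (N + 1) → Kind) :
    unread d (readLetter d c) (readRest d c) = c := by
  unfold readLetter readRest unread
  by_cases hd : 0 ≤ d
  · by_cases hx : c 0 = .large
    · simp only [hd, hx, if_true]
      rw [← hx, ← flipEnds_last c, Fin.snoc_init_self, flipEnds_flipEnds]
    · simp only [hd, hx, if_true, if_false]
      exact Fin.cons_self_tail c
  · by_cases hx : c (Fin.last N) = .large
    · simp only [hd, hx, if_true, if_false]
      rw [← hx, Fin.snoc_init_self]
    · simp only [hd, hx, if_false]
      rw [← flipEnds_zero c, Fin.cons_self_tail, flipEnds_flipEnds]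

/-- Reading a letter is a bijection. -/
def readEquiv (N : ℕ) (d : ℤ) : (Fin (N + 1) → Kind) ≃ Kind × (Fin N → Kind) where
  toFun c := (readLetter d c, readRest d c)
  invFun y := unread d y.1 y.2
  left_inv c := unread_read d c
  right_inv y := Prod.ext (readLetter_unread d y.1 y.2) (readRest_unread d y.1 y.2)

/-- The number of occurrences of `x` in `c`. -/
def letterCount (c : Fin N → Kind) (x : Kind) : ℕ := ∑ t, if c t = x then 1 else 0

theorem letterCount_flipEnds (c : Fin (N + 1) → Kind) :
    letterCount (flipEnds c) = letterCount c := by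
  funext y
  exact Equiv.sum_comp (Equiv.swap 0 (Fin.last N)) (fun t => if c t = y then 1 else 0)

theorem letterCount_cons (x : Kind) (w : Fin N → Kind) :
    letterCount (Fin.cons x w : Fin (N + 1) → Kind) = letterCount w + Pi.single x 1 := by
  funext y
  simp only [letterCount, Fin.sum_univ_succ, Fin.cons_zero, Fin.cons_succ, Pi.add_apply,
    Pi.single_apply, eq_comm (a := x)]
  ring

theorem letterCount_snoc (x : Kind) (w : Fin N → Kind) :
    letterCount (Fin.snoc w x : Fin (N + 1) → Kind) = letterCount w + Pi.single x 1 := by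
  funext y
  simp only [letterCount, Fin.sum_univ_castSucc, Fin.snoc_last, Fin.snoc_castSucc, Pi.add_apply,
    Pi.single_apply, eq_comm (a := x)]

theorem letterCount_unread (d : ℤ) (x : Kind) (w : Fin N → Kind) :
    letterCount (unread d x w) = letterCount w + Pi.single x 1 := by
  unfold unread
  split_ifs <;> simp only [letterCount_flipEnds, letterCount_cons, letterCount_snoc]

theorem sum_words_read (d : ℤ) (F : (Fin (N + 1) → Kind) → ℚ) :
    ∑ c, F c = ∑ x, ∑ w, F (unread d x w) := by
  rw [← Fintype.sum_prod_type' (f := fun x w => F (unread d x w))]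
  exact (Equiv.sum_comp (readEquiv N d).symm F).symm

theorem sum_words_cons (F : (Fin (N + 1) → Kind) → ℚ) :
    ∑ c, F c = ∑ x, ∑ w, F (Fin.cons x w : Fin (N + 1) → Kind) := by
  rw [← Fintype.sum_prod_type' (f := fun x w => F (Fin.cons x w : Fin (N + 1) → Kind))]
  exact (Equiv.sum_comp (Fin.consEquiv fun _ => Kind) F).symm

theorem sum_words_snoc (F : (Fin (N + 1) → Kind) → ℚ) :
    ∑ c, F c = ∑ x, ∑ w, F (Fin.snoc w x : Fin (N + 1) → Kind) := by
  rw [← Fintype.sum_prod_type' (f := fun x w => F (Fin.snoc w x : Fin (N + 1) → Kind))]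
  exact (Equiv.sum_comp (Fin.snocEquiv fun _ => Kind) F).symm

/-- The order in which the loop reads the elements is immaterial on average. -/
theorem sum_loopCost_eq_sum_scanCost (N : ℕ) (d : ℤ) (h : (Kind → ℕ) → ℚ) :
    ∑ c, h (letterCount c) * loopCost N d c = ∑ c, h (letterCount c) * scanCost N d c := by
  induction N generalizing d h with
  | zero => rfl
  | succ N ih =>
    -- Left: words are split by `readEquiv`. Right: words are split at the first letter. Both give a
    -- letter and an arbitrary rest, with the same cost and the same change of `d`.
    rw [sum_words_read d, sum_words_cons]
    refine Finset.sum_congr rfl fun x _ => ?_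
    simp only [letterCount_unread, letterCount_cons, loopCost, scanCost, readLetter_unread,
      readRest_unread, Fin.cons_zero, Fin.tail_cons, mul_add, Finset.sum_add_distrib]
    congr 1
    -- The weight depends on letter counts only; with `x` split off it is again such a weight of the
    -- rest, which is why the induction runs over all `h`.
    exact ih (d + x.drift) (fun k => h (k + Pi.single x 1))

/-- The definition peels off the first letter, which changes the starting difference. Peeling off
the last letter keeps it at `0` and yields a recurrence in `N` alone. -/
theorem scanCost_snoc (N : ℕ) (d : ℤ) (w : Fin N → Kind) (x : Kind) :
    scanCost (N + 1) d (Fin.snoc w x) = scanCost N d w + readCost (d + ∑ t, (w t).drift) x := by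
  induction N generalizing d with
  | zero => simp [scanCost, Fin.snoc]
  | succ N ih =>
    have h₁ : Fin.tail (Fin.snoc w x : Fin (N + 2) → Kind) = Fin.snoc (Fin.tail w) x := by
      funext t
      refine Fin.lastCases ?_ (fun t => ?_) t
      · simp only [Fin.tail, Fin.succ_last, Fin.snoc_last]
      · simp only [Fin.tail, Fin.succ_castSucc, Fin.snoc_castSucc]
    rw [scanCost.eq_2 d N.succ, h₁, ih, scanCost.eq_2, Fin.sum_univ_succ]
    have h₂ : (Fin.snoc w x : Fin (N + 2) → Kind) 0 = w 0 := Fin.snoc_apply_zero _ _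
    rw [h₂]
    simp only [Fin.tail]
    rw [← add_assoc, add_assoc d]

theorem sum_drift (w : Fin N → Kind) :
    ∑ t, (w t).drift = (letterCount w .small : ℤ) - letterCount w .large := by
  unfold letterCount
  push_cast
  rw [← Finset.sum_sub_distrib]
  refine Finset.sum_congr rfl fun t _ => ?_
  cases w t <;> simp [Kind.drift]

end Words

/-! ### The partitioning loop acts on the word of classes -/

section LoopWord

variable {α : Type*} [LinearOrder α]

/-- The class of the element `x` with respect to the pivots `p` and `q`. -/
def kindOf (p q x : α) : Kind := if x < p then .small else if x < q then .medium else .large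

/-- The word of the classes of the entries of `A` at the `N` positions from `j` on. -/
def arrayWord (p q : α) (A : ℤ → α) (j : ℤ) (N : ℕ) : Fin N → Kind :=
  fun t => kindOf p q (A (j + t))

theorem kindOf_eq_large {p q x : α} (hpq : p ≤ q) : kindOf p q x = .large ↔ ¬x < q := by
  unfold kindOf
  split_ifs with h₁ h₂
  · simp [h₁.trans_le hpq]
  · simp [h₂]
  · simp [h₂]

/-- The unread entries after one step. -/
theorem step_unread (p q : α) (hpq : p ≤ q) (s : State α) (hij : s.i ≤ s.j) (hjk : s.j ≤ s.k)
    (hq : s.A s.k ≠ q) {t : ℤ} (h₁ : (step p q s).j ≤ t) (h₂ : t ≤ (step p q s).k) :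
    (step p q s).A t =
      if 0 ≤ s.d then
        if s.A s.j < q then s.A t else if t = s.j then s.A s.k else s.A t
      else
        if s.A s.k < q then if t = s.k then s.A s.j else s.A t else s.A t := by
  have key : ∀ (A : ℤ → α) (x y t : ℤ), swapAt A x y t =
      if t = y then A x else if t = x then A y else A t := fun A x y t => by
    simp only [swapAt, Function.update_apply]
  have key' : ∀ (A : ℤ → α) (x y z t : ℤ), x ≤ y → y ≤ z → rotate3 A z y x t =
      if t = x then A z else if t = y then A x else if t = z then A y else A t := by
    intro A x y z t hxy hyz
    simp only [rotate3, Function.update_apply]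
    split_ifs <;> first | rfl | (congr 1; omega)
  unfold step at h₁ h₂ ⊢
  split_ifs at h₁ h₂ ⊢
  all_goals simp only [key, key' _ _ _ _ _ hij hjk] at h₁ h₂ ⊢
  all_goals grind

theorem step_jk (p q : α) (hpq : p ≤ q) (s : State α) (hq : s.A s.k ≠ q) :
    (step p q s).j = (if 0 ≤ s.d then if s.A s.j < q then s.j + 1 else s.j
      else if s.A s.k < q then s.j + 1 else s.j) ∧
    (step p q s).k = (if 0 ≤ s.d then if s.A s.j < q then s.k else s.k - 1
      else if s.A s.k < q then s.k else s.k - 1) := by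
  unfold step
  split_ifs <;> grind

/-- When a large element is read on the left or a non-large one on the right, the unread element at
the other end moves into the vacated cell; this is the exchange of ends in `readRest`. In the other
cases the end just read is dropped. -/
theorem loop_swaps (p q : α) (hpq : p ≤ q) (N : ℕ) (s : State α) (hij : s.i ≤ s.j)
    (hN : s.k = s.j + N - 1) (hq : ∀ t, s.j ≤ t → t ≤ s.k → s.A t ≠ q) :
    (loop p q s).swaps = s.swaps + loopCost N s.d (arrayWord p q s.A s.j N) := by
  induction N generalizing s with
  | zero => rw [loop, if_neg (by omega), loopCost, add_zero]
  | succ N ih =>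
    have hjk : s.j ≤ s.k := by push_cast at hN; omega
    have hgap := step_gap p q s
    have hb := step_bounds p q s hij
    have hfst : arrayWord p q s.A s.j (N + 1) 0 = kindOf p q (s.A s.j) := by simp [arrayWord]
    have hlst : arrayWord p q s.A s.j (N + 1) (Fin.last N) = kindOf p q (s.A s.k) := by
      simp only [arrayWord, Fin.val_last]
      congr 2
      push_cast at hN
      omega
    have hqj := hq s.j le_rfl hjk
    have hqk := hq s.k hjk le_rfl
    have hsw : (step p q s).swaps = s.swaps +
          readCost s.d (readLetter s.d (arrayWord p q s.A s.j (N + 1))) ∧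
        (step p q s).d = s.d + (readLetter s.d (arrayWord p q s.A s.j (N + 1))).drift := by
      simp only [readLetter, hfst, hlst]
      unfold step kindOf
      split_ifs <;> simp_all [readCost, Kind.drift] <;> grind
    have hword : arrayWord p q (step p q s).A (step p q s).j N =
        readRest s.d (arrayWord p q s.A s.j (N + 1)) := by
      funext t
      have ht := t.2
      obtain ⟨hj', hk'⟩ := step_jk p q hpq s hqk
      have hA := step_unread p q hpq s hij hjk hqk (t := (step p q s).j + t) (by omega)
        (by push_cast at hN; omega)
      simp only [arrayWord] at hfst hlst
      simp only [readRest, arrayWord, hfst, hlst, kindOf_eq_large hpq]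
      rw [hA]
      split_ifs at hj' hk' ⊢
      all_goals simp only [Fin.init, Fin.tail, flipEnds_castSucc, flipEnds_succ, hj', arrayWord,
        Fin.val_succ, Fin.val_castSucc, Fin.val_last]
      all_goals push_cast at hN ⊢
      all_goals try split_ifs
      all_goals first | omega | (congr 2 <;> omega) | (congr 2; simp)
    have hun : ∀ t, (step p q s).j ≤ t → t ≤ (step p q s).k → (step p q s).A t ≠ q := by
      intro t h₁ h₂
      obtain ⟨hj', hk'⟩ := step_jk p q hpq s hqk
      have htj := hq t
      rw [step_unread p q hpq s hij hjk hqk h₁ h₂]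
      grind
    rw [loop, if_pos hjk, ih _ hb.2.1 (by push_cast at hN; omega) hun, hword, hsw.1, hsw.2,
      loopCost, add_assoc]

end LoopWord

/-! ### How many permutations have a given word -/

section Counting

/-- The number of permutations carrying `f` to a function `g` with fibres of the same sizes. -/
theorem card_perm_comp_eq {α ι : Type*} [Fintype α] [DecidableEq α] [Fintype ι] [DecidableEq ι]
    (f g : α → ι) (h : ∀ i, Fintype.card {a // f a = i} = Fintype.card {a // g a = i}) :
    Fintype.card {σ : Equiv.Perm α // f ∘ σ = g} =
      ∏ i, (Fintype.card {a // g a = i}).factorial := by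
  -- One solution `σ₀` exists because the fibres match in size. All others are `σ₀ * τ` with `τ` in
  -- the stabilizer of `g`, whose order is the product of the factorials.
  let σ₀ : Equiv.Perm α := Equiv.ofFiberEquiv fun i => (Fintype.equivOfCardEq (h i)).symm
  have hσ₀ : f ∘ σ₀ = g := funext fun a => Equiv.ofFiberEquiv_map _ a
  rw [← DomMulAct.stabilizer_card]
  refine (Fintype.card_congr ((Equiv.mulLeft σ₀).subtypeEquiv fun τ => ?_)).symm
  change g ∘ τ = g ↔ f ∘ (σ₀ ∘ τ) = g
  rw [← Function.comp_assoc, hσ₀]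

theorem prod_kind {M : Type*} [CommMonoid M] (f : Kind → M) :
    ∏ x, f x = f .small * f .medium * f .large := by
  have h : (Finset.univ : Finset Kind) = {.small, .medium, .large} := rfl
  rw [h, Finset.prod_insert (by decide), Finset.prod_insert (by decide), Finset.prod_singleton,
    mul_assoc]

variable {N : ℕ}

/-- The word of the classes of the non-pivot elements. -/
def word (σ : Equiv.Perm (Fin (N + 2))) : Fin N → Kind :=
  fun t => kindOf (lowPivot σ) (highPivot σ) (σ t.castSucc.succ : ℕ)

/-- The classes of all values, the two pivots `p` and `q` forming classes of their own. -/
def valueClass (p q : ℕ) (v : Fin (N + 2)) : Kind ⊕ Bool :=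
  if (v : ℕ) = p then .inr false else if (v : ℕ) = q then .inr true else .inl (kindOf p q (v : ℕ))

/-- The classes of all positions, if `b` says which pivot is the first one. -/
def positionClass (b : Bool) (c : Fin N → Kind) : Fin (N + 2) → Kind ⊕ Bool :=
  Fin.cons (.inr b) (Fin.snoc (fun t => Sum.inl (c t)) (.inr !b) : Fin (N + 1) → Kind ⊕ Bool)

theorem positionClass_zero (b : Bool) (c : Fin N → Kind) : positionClass b c 0 = .inr b := rfl

theorem positionClass_last (b : Bool) (c : Fin N → Kind) :
    positionClass b c (Fin.last _) = .inr !b := by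
  rw [← Fin.succ_last, positionClass, Fin.cons_succ, Fin.snoc_last]

theorem positionClass_inner (b : Bool) (c : Fin N → Kind) (t : Fin N) :
    positionClass b c t.castSucc.succ = .inl (c t) := by
  rw [positionClass, Fin.cons_succ, Fin.snoc_castSucc]

theorem sum_positions {M : Type*} [AddCommMonoid M] (f : Fin (N + 2) → M) :
    ∑ t, f t = f 0 + (∑ t : Fin N, f t.castSucc.succ + f (Fin.last _)) := by
  rw [Fin.sum_univ_succ, Fin.sum_univ_castSucc, Fin.succ_last]

theorem letterCount_add (c : Fin N → Kind) :
    letterCount c .small + letterCount c .medium + letterCount c .large = N := by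
  unfold letterCount
  rw [← Finset.sum_add_distrib, ← Finset.sum_add_distrib]
  have : ∀ t, ((if c t = .small then 1 else 0) + (if c t = .medium then 1 else 0)) +
      (if c t = .large then 1 else 0) = 1 := by
    intro t
    cases c t <;> rfl
  simp [this]

theorem sum_fin_lt {n a : ℕ} (h : a ≤ n) : ∑ v : Fin n, (if (v : ℕ) < a then 1 else 0) = a := by
  rw [Fin.sum_univ_eq_sum_range (fun v => if v < a then 1 else 0), ← Finset.card_filter]
  have : (Finset.range n).filter (· < a) = Finset.range a := by
    ext v
    simp only [Finset.mem_filter, Finset.mem_range]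
    omega
  rw [this, Finset.card_range]

theorem sum_perm_lt (σ : Equiv.Perm (Fin (N + 2))) {a : ℕ} (h : a ≤ N + 2) :
    ∑ t, (if (σ t : ℕ) < a then 1 else 0) = a := by
  rw [Equiv.sum_comp σ (fun v => if (v : ℕ) < a then 1 else 0), sum_fin_lt h]

theorem lowPivot_eq_letterCount (σ : Equiv.Perm (Fin (N + 2))) :
    letterCount (word σ) .small = lowPivot σ := by
  have hlt := lowPivot_lt_highPivot σ
  have hlt' := highPivot_lt σ
  have h := sum_perm_lt σ (a := lowPivot σ) (by omega)
  rw [sum_positions, if_neg (by unfold lowPivot; omega), if_neg (by unfold lowPivot; omega),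
    zero_add, add_zero] at h
  rw [← h, letterCount]
  refine Finset.sum_congr rfl fun t _ => ?_
  unfold word kindOf
  split_ifs <;> simp_all

theorem highPivot_eq_letterCount (σ : Equiv.Perm (Fin (N + 2))) :
    letterCount (word σ) .small + letterCount (word σ) .medium + 1 = highPivot σ := by
  have hlt := lowPivot_lt_highPivot σ
  have hlt' := highPivot_lt σ
  have h := sum_perm_lt σ (a := highPivot σ) (by omega)
  rw [sum_positions] at h
  have hends : (if (σ 0 : ℕ) < highPivot σ then 1 else 0) +
      (if (σ (Fin.last _) : ℕ) < highPivot σ then 1 else 0) = 1 := by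
    unfold lowPivot highPivot at *
    split_ifs <;> omega
  have hsum : letterCount (word σ) .small + letterCount (word σ) .medium =
      ∑ t : Fin N, (if (σ t.castSucc.succ : ℕ) < highPivot σ then 1 else 0) := by
    rw [letterCount, letterCount, ← Finset.sum_add_distrib]
    refine Finset.sum_congr rfl fun t _ => ?_
    unfold word kindOf
    split_ifs <;> simp_all
    omega
  omega

theorem valueClass_eq_low {p q : ℕ} {v : Fin (N + 2)} :
    valueClass p q v = .inr false ↔ (v : ℕ) = p := by
  unfold valueClass
  split_ifs <;> simp_all

theorem valueClass_eq_high {p q : ℕ} (hpq : p < q) {v : Fin (N + 2)} :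
    valueClass p q v = .inr true ↔ (v : ℕ) = q := by
  unfold valueClass
  split_ifs <;> simp_all
  omega

theorem valueClass_eq_kind {p q : ℕ} {v : Fin (N + 2)} {x : Kind} :
    valueClass p q v = .inl x ↔ (v : ℕ) ≠ p ∧ (v : ℕ) ≠ q ∧ kindOf p q (v : ℕ) = x := by
  unfold valueClass
  split_ifs <;> simp_all

/-- The letter counts of the word already determine both pivots. Fixing the word therefore
prescribes the class of the value at every position, up to the choice of the end that holds the
smaller pivot. -/
theorem word_eq_iff (σ : Equiv.Perm (Fin (N + 2))) (c : Fin N → Kind) :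
    word σ = c ↔
      valueClass (letterCount c .small) (letterCount c .small + letterCount c .medium + 1) ∘ σ =
          positionClass false c ∨
        valueClass (letterCount c .small) (letterCount c .small + letterCount c .medium + 1) ∘ σ =
          positionClass true c := by
  have hpos : ∀ (P : Fin (N + 2) → Prop), (P 0 ∧ P (Fin.last _) ∧ ∀ t : Fin N, P t.castSucc.succ) →
      ∀ t, P t := by
    rintro P ⟨h₁, h₂, h₃⟩ t
    refine Fin.cases h₁ (fun t => ?_) t
    refine Fin.lastCases ?_ (fun t => h₃ t) t
    rwa [Fin.succ_last]
  constructor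
  · rintro rfl
    rw [highPivot_eq_letterCount, lowPivot_eq_letterCount]
    have hlt := lowPivot_lt_highPivot σ
    have hinner : ∀ t : Fin N, valueClass (lowPivot σ) (highPivot σ) (σ t.castSucc.succ) =
        .inl (word σ t) := by
      intro t
      rw [valueClass_eq_kind]
      have h₁ : σ t.castSucc.succ ≠ σ 0 := fun h => absurd (σ.injective h) (Fin.succ_ne_zero _)
      have h₂ : σ t.castSucc.succ ≠ σ (Fin.last _) := fun h => by
        have := congrArg Fin.val (σ.injective h)
        simp at this
        omega
      rw [ne_eq, Fin.ext_iff] at h₁ h₂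
      refine ⟨?_, ?_, rfl⟩
      · unfold lowPivot
        omega
      · unfold highPivot
        omega
    rcases lt_or_ge (σ 0 : ℕ) (σ (Fin.last _)) with h | h
    · left
      refine funext (hpos _ ⟨?_, ?_, fun t => ?_⟩)
      · rw [positionClass_zero, Function.comp, valueClass_eq_low, lowPivot]
        omega
      · rw [positionClass_last, Function.comp, Bool.not_false, valueClass_eq_high hlt, highPivot]
        omega
      · rw [positionClass_inner, Function.comp, hinner]
    · right
      refine funext (hpos _ ⟨?_, ?_, fun t => ?_⟩)
      · rw [positionClass_zero, Function.comp, valueClass_eq_high hlt, highPivot]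
        omega
      · rw [positionClass_last, Function.comp, Bool.not_true, valueClass_eq_low, lowPivot]
        omega
      · rw [positionClass_inner, Function.comp, hinner]
  · generalize hp : letterCount c .small = p
    generalize hq : p + letterCount c .medium + 1 = q
    have hpq : p < q := by omega
    intro h
    have hpiv : lowPivot σ = p ∧ highPivot σ = q := by
      rcases h with h | h
      · have h₀ := congrFun h 0
        have h₁ := congrFun h (Fin.last _)
        rw [positionClass_zero, Function.comp, valueClass_eq_low] at h₀
        rw [positionClass_last, Function.comp, Bool.not_false, valueClass_eq_high hpq] at h₁
        unfold lowPivot highPivot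
        omega
      · have h₀ := congrFun h 0
        have h₁ := congrFun h (Fin.last _)
        rw [positionClass_zero, Function.comp, valueClass_eq_high hpq] at h₀
        rw [positionClass_last, Function.comp, Bool.not_true, valueClass_eq_low] at h₁
        unfold lowPivot highPivot
        omega
    funext t
    rw [word, hpiv.1, hpiv.2]
    rcases h with h | h
    all_goals
      have := congrFun h t.castSucc.succ
      rw [positionClass_inner, Function.comp, valueClass_eq_kind] at this
      exact this.2.2

theorem card_positionClass (b : Bool) (c : Fin N → Kind) (i : Kind ⊕ Bool) :
    Fintype.card {t // positionClass b c t = i} = Sum.elim (letterCount c) (fun _ => 1) i := by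
  rw [Fintype.card_subtype, Finset.card_filter, sum_positions, positionClass_zero,
    positionClass_last]
  simp only [positionClass_inner]
  rcases i with x | b'
  · simp [letterCount]
  · cases b <;> cases b' <;> simp

theorem card_valueClass {p q : ℕ} (hpq : p < q) (hq : q ≤ N + 1) (i : Kind ⊕ Bool) :
    Fintype.card {v : Fin (N + 2) // valueClass p q v = i} =
      Sum.elim (fun x => match x with
        | .small => p
        | .medium => q - p - 1
        | .large => N + 1 - q) (fun _ => 1) i := by
  rw [Fintype.card_subtype]
  have hcard : ∀ (P : ℕ → Prop) [DecidablePred P] (s : Finset ℕ),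
      (∀ v, v ∈ s ↔ v < N + 2 ∧ P v) → (∀ v : Fin (N + 2), valueClass p q v = i ↔ P v) →
      (Finset.univ.filter fun v : Fin (N + 2) => valueClass p q v = i).card = s.card := by
    intro P _ s hs hP
    simp only [hP]
    rw [Finset.card_filter, Fin.sum_univ_eq_sum_range (fun v => if P v then 1 else 0),
      ← Finset.card_filter]
    congr 1
    ext v
    rw [Finset.mem_filter, Finset.mem_range, hs]
  rcases i with (_ | _ | _) | (_ | _)
  · rw [hcard (fun v => v < p) (Finset.range p)]
    · simp
    · intro v
      rw [Finset.mem_range]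
      omega
    · intro v
      rw [valueClass_eq_kind]
      unfold kindOf
      split_ifs <;> simp_all
      omega
  · rw [hcard (fun v => p < v ∧ v < q) (Finset.Ioo p q)]
    · simp
    · intro v
      rw [Finset.mem_Ioo]
      omega
    · intro v
      rw [valueClass_eq_kind]
      unfold kindOf
      split_ifs <;> simp_all <;> omega
  · rw [hcard (fun v => q < v) (Finset.Ioc q (N + 1))]
    · simp
    · intro v
      rw [Finset.mem_Ioc]
      omega
    · intro v
      rw [valueClass_eq_kind]
      unfold kindOf
      split_ifs <;> simp_all <;> omega
  · rw [hcard (fun v => v = p) {p}]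
    · simp
    · intro v
      rw [Finset.mem_singleton]
      omega
    · intro v
      rw [valueClass_eq_low]
  · rw [hcard (fun v => v = q) {q}]
    · simp
    · intro v
      rw [Finset.mem_singleton]
      omega
    · intro v
      rw [valueClass_eq_high hpq]

/-- The product of the factorials of the letter counts. -/
def weight (k : Kind → ℕ) : ℚ :=
  (k .small).factorial * (k .medium).factorial * (k .large).factorial

/-- The factor `2` counts the two orders of the pivots; in each of them the pivot classes are
singletons and contribute `1!`. -/
theorem card_word_eq (c : Fin N → Kind) :
    (((Finset.univ : Finset (Equiv.Perm (Fin (N + 2)))).filter fun σ => word σ = c).card : ℚ) =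
      2 * weight (letterCount c) := by
  classical
  have hadd := letterCount_add c
  set f : Fin (N + 2) → Kind ⊕ Bool :=
    valueClass (letterCount c .small) (letterCount c .small + letterCount c .medium + 1) with hf
  have hone : ∀ b, (((Finset.univ : Finset (Equiv.Perm (Fin (N + 2)))).filter
      fun σ : Equiv.Perm (Fin (N + 2)) => f ∘ σ = positionClass b c).card : ℚ) = weight (letterCount c) := by
    intro b
    rw [← Fintype.card_subtype, card_perm_comp_eq]
    · simp only [card_positionClass, Fintype.prod_sum_type, Sum.elim_inl, Sum.elim_inr,
        Nat.factorial_one, Finset.prod_const_one, mul_one, prod_kind]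
      push_cast
      rfl
    · intro i
      rw [card_positionClass, hf, card_valueClass (by omega) (by omega)]
      rcases i with (_ | _ | _) | _
      all_goals simp only [Sum.elim_inl, Sum.elim_inr]
      all_goals omega
  have hunion : (Finset.univ : Finset (Equiv.Perm (Fin (N + 2)))).filter (fun σ => word σ = c) =
      (Finset.univ.filter fun σ : Equiv.Perm (Fin (N + 2)) => f ∘ σ = positionClass false c) ∪
        (Finset.univ.filter fun σ : Equiv.Perm (Fin (N + 2)) => f ∘ σ = positionClass true c) := by
    ext σ
    simp only [Finset.mem_filter, Finset.mem_univ, true_and, Finset.mem_union, word_eq_iff, hf]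
  rw [hunion, Finset.card_union_of_disjoint]
  · push_cast
    rw [hone, hone]
    ring
  · rw [Finset.disjoint_filter]
    intro σ _ h₁ h₂
    have := congrFun (h₁.symm.trans h₂) 0
    simp [positionClass_zero] at this

theorem sum_word (F : (Fin N → Kind) → ℚ) :
    ∑ σ : Equiv.Perm (Fin (N + 2)), F (word σ) = ∑ c, 2 * weight (letterCount c) * F c := by
  classical
  rw [← Finset.sum_fiberwise (g := word)]
  refine Finset.sum_congr rfl fun c _ => ?_
  rw [Finset.sum_congr rfl (g := fun _ => F c), Finset.sum_const, nsmul_eq_mul, card_word_eq]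
  intro σ hσ
  rw [(Finset.mem_filter.mp hσ).2]

theorem loopSwaps_eq (σ : Equiv.Perm (Fin (N + 2))) : loopSwaps σ = loopCost N 0 (word σ) := by
  have hlt := lowPivot_lt_highPivot σ
  have hn : (((N + 2 : ℕ) : ℤ) - 1) = N + 1 := by push_cast; ring
  rw [loopSwaps, afterLoop, pivotP_inputArray, pivotQ_inputArray, loop_swaps _ _ hlt.le N]
  · rw [zero_add]
    congr 1
    funext t
    simp only [arrayWord, word]
    rw [← inputArray_coe]
    congr 2
    simp
    ring
  · exact le_rfl
  · simp only [hn]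
    ring
  · intro t h₁ h₂ h
    simp only [hn] at h₁ h₂ h
    obtain ⟨u, hu⟩ : ∃ u : Fin N, t = ((u.castSucc.succ : Fin (N + 2)) : ℕ) :=
      ⟨⟨(t - 1).toNat, by omega⟩, by simp; omega⟩
    rw [hu, inputArray_coe] at h
    have h₁ : σ u.castSucc.succ ≠ σ 0 := fun h => absurd (σ.injective h) (Fin.succ_ne_zero _)
    have h₂ : σ u.castSucc.succ ≠ σ (Fin.last _) := fun h => by
      have := congrArg Fin.val (σ.injective h)
      simp at this
      omega
    rw [ne_eq, Fin.ext_iff] at h₁ h₂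
    unfold highPivot at h
    omega

end Counting

/-! ### Urn weights and the recurrence for the mean -/

section Recurrence

/-- The sum of `φ s m l` over all `s + m + l = N`. -/
def triangleSum (N : ℕ) (φ : ℕ → ℕ → ℕ → ℚ) : ℚ :=
  ∑ x ∈ Finset.HasAntidiagonal.antidiagonal N, ∑ y ∈ Finset.HasAntidiagonal.antidiagonal x.2, φ x.1 y.1 y.2

theorem triangleSum_add (N : ℕ) (φ ψ : ℕ → ℕ → ℕ → ℚ) :
    triangleSum N (fun s m l => φ s m l + ψ s m l) = triangleSum N φ + triangleSum N ψ := by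
  simp only [triangleSum, Finset.sum_add_distrib]

theorem triangleSum_congr {N : ℕ} {φ ψ : ℕ → ℕ → ℕ → ℚ}
    (h : ∀ s m l, s + m + l = N → φ s m l = ψ s m l) : triangleSum N φ = triangleSum N ψ := by
  refine Finset.sum_congr rfl fun x hx => Finset.sum_congr rfl fun y hy => h _ _ _ ?_
  rw [Finset.HasAntidiagonal.mem_antidiagonal] at hx hy
  omega

theorem triangleSum_mul_left (N : ℕ) (a : ℚ) (φ : ℕ → ℕ → ℕ → ℚ) :
    triangleSum N (fun s m l => a * φ s m l) = a * triangleSum N φ := by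
  simp only [triangleSum, Finset.mul_sum]

theorem triangleSum_succ_fst (N : ℕ) (φ : ℕ → ℕ → ℕ → ℚ) :
    triangleSum (N + 1) (fun s m l => s * φ s m l) =
      triangleSum N (fun s m l => (s + 1) * φ (s + 1) m l) := by
  simp [triangleSum, Finset.Nat.sum_antidiagonal_succ]

theorem triangleSum_succ_snd (N : ℕ) (φ : ℕ → ℕ → ℕ → ℚ) :
    triangleSum (N + 1) (fun s m l => m * φ s m l) =
      triangleSum N (fun s m l => (m + 1) * φ s (m + 1) l) := by
  simp [triangleSum, Finset.Nat.sum_antidiagonal_succ' (n := N), Finset.Nat.sum_antidiagonal_succ]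

theorem triangleSum_succ_trd (N : ℕ) (φ : ℕ → ℕ → ℕ → ℚ) :
    triangleSum (N + 1) (fun s m l => l * φ s m l) =
      triangleSum N (fun s m l => (l + 1) * φ s m (l + 1)) := by
  simp [triangleSum, Finset.Nat.sum_antidiagonal_succ']

theorem weight_add_single (k : Kind → ℕ) (x : Kind) :
    weight (k + Pi.single x 1) = (k x + 1) * weight k := by
  cases x <;> simp [weight, Nat.factorial_succ] <;> ring

/-- Weighted by the factorials, all letter counts are equally likely. -/
theorem sum_weight (N : ℕ) (φ : ℕ → ℕ → ℕ → ℚ) :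
    ∑ c : Fin N → Kind, weight (letterCount c) *
        φ (letterCount c .small) (letterCount c .medium) (letterCount c .large) =
      N.factorial * triangleSum N φ := by
  induction N generalizing φ with
  | zero => simp [triangleSum, weight, letterCount]
  | succ N ih =>
    rw [sum_words_snoc, sum_kind]
    simp only [letterCount_snoc, weight_add_single]
    have h₁ := ih (fun s m l => (s + 1) * φ (s + 1) m l)
    have h₂ := ih (fun s m l => (m + 1) * φ s (m + 1) l)
    have h₃ := ih (fun s m l => (l + 1) * φ s m (l + 1))
    rw [← triangleSum_succ_fst] at h₁
    rw [← triangleSum_succ_snd] at h₂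
    rw [← triangleSum_succ_trd] at h₃
    -- Adding a last letter `x` multiplies the weight by the new count of `x`. Since the counts sum
    -- to `N + 1`, the three contributions recombine into the factor that turns `N!` into `(N +
    -- 1)!`.
    have h : triangleSum (N + 1) (fun s m l => s * φ s m l) +
        triangleSum (N + 1) (fun s m l => m * φ s m l) +
        triangleSum (N + 1) (fun s m l => l * φ s m l) = (N + 1) * triangleSum (N + 1) φ := by
      rw [← triangleSum_add, ← triangleSum_add, ← triangleSum_mul_left]
      refine triangleSum_congr fun s m l h => ?_
      have : (s : ℚ) + m + l = N + 1 := by exact_mod_cast h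
      rw [← this]
      ring
    rw [Nat.factorial_succ]
    push_cast
    rw [mul_comm ((N : ℚ) + 1), mul_assoc, ← h, mul_add, mul_add, ← h₁, ← h₂, ← h₃]
    congr 1
    · congr 1
      · refine Finset.sum_congr rfl fun w _ => ?_
        simp
        ring
      · refine Finset.sum_congr rfl fun w _ => ?_
        simp
        ring
    · refine Finset.sum_congr rfl fun w _ => ?_
      simp
      ring

/-- The total cost of the next step, over all letter counts of the letters read so far. -/
def stepCost (N : ℕ) : ℚ :=
  triangleSum N fun s m l => (s + 1) * readCost ((s : ℤ) - l) .small +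
    (m + 1) * readCost ((s : ℤ) - l) .medium + (l + 1) * readCost ((s : ℤ) - l) .large

/-- The weighted total cost of all words. -/
def totalCost (N : ℕ) : ℚ := ∑ c : Fin N → Kind, weight (letterCount c) * scanCost N 0 c

theorem totalCost_zero : totalCost 0 = 0 := by simp [totalCost, scanCost]

/-- After a prefix with counts `s, m, l`, the weights of the three possible last letters are `s +
1`, `m + 1`, `l + 1`. Their sum `N + 3` multiplies the cost of the prefix; the cost of the last
letter itself, averaged by `sum_weight`, gives `stepCost`. -/
theorem totalCost_succ (N : ℕ) :
    totalCost (N + 1) = (N + 3) * totalCost N + N.factorial * stepCost N := by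
  rw [stepCost, ← sum_weight, totalCost, totalCost, sum_words_snoc, sum_kind, Finset.mul_sum,
    ← Finset.sum_add_distrib, ← Finset.sum_add_distrib, ← Finset.sum_add_distrib]
  refine Finset.sum_congr rfl fun w _ => ?_
  simp only [letterCount_snoc, weight_add_single, scanCost_snoc, sum_drift, zero_add]
  have : (letterCount w .small : ℚ) + letterCount w .medium + letterCount w .large = N := by
    exact_mod_cast letterCount_add w
  rw [← this]
  ring

theorem triangleSum_fst (N : ℕ) (e : ℕ → ℚ) :
    triangleSum N (fun s _ _ => e s) = ∑ s ∈ Finset.range (N + 1), ((N : ℚ) + 1 - s) * e s := by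
  rw [triangleSum, Finset.Nat.sum_antidiagonal_eq_sum_range_succ_mk]
  refine Finset.sum_congr rfl fun s hs => ?_
  have : s ≤ N := by
    rw [Finset.mem_range] at hs
    omega
  simp only [Finset.sum_const, Finset.Nat.card_antidiagonal, nsmul_eq_mul]
  rw [Nat.cast_add, Nat.cast_sub this]
  ring

theorem antidiagonal_sum_comm (n : ℕ) (f : ℕ → ℕ → ℚ) :
    ∑ y ∈ Finset.HasAntidiagonal.antidiagonal n, f y.1 y.2 = ∑ y ∈ Finset.HasAntidiagonal.antidiagonal n, f y.2 y.1 :=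
  (Finset.Nat.sum_antidiagonal_swap (f := fun y => f y.1 y.2)).symm

theorem triangleSum_swap_snd_trd (N : ℕ) (φ : ℕ → ℕ → ℕ → ℚ) :
    triangleSum N φ = triangleSum N (fun s m l => φ s l m) :=
  Finset.sum_congr rfl fun _ _ => antidiagonal_sum_comm _ _

theorem triangleSum_rotate (N : ℕ) (φ : ℕ → ℕ → ℕ → ℚ) :
    triangleSum N φ = triangleSum N (fun s m l => φ l s m) := by
  rw [triangleSum, triangleSum, Finset.sum_sigma', Finset.sum_sigma']
  refine Finset.sum_nbij' (fun z => ⟨(z.2.1, z.2.2 + z.1.1), (z.2.2, z.1.1)⟩)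
    (fun z => ⟨(z.2.2, z.1.1 + z.2.1), (z.1.1, z.2.1)⟩) ?_ ?_ ?_ ?_ ?_
  all_goals
    rintro ⟨⟨s, u⟩, ⟨m, l⟩⟩ hz
    simp only [Finset.mem_sigma, Finset.HasAntidiagonal.mem_antidiagonal] at hz ⊢
  · exact ⟨by omega, trivial⟩
  · exact ⟨by omega, trivial⟩
  · obtain ⟨-, rfl⟩ := hz
    rfl
  · obtain ⟨-, rfl⟩ := hz
    simp

theorem triangleSum_snd (N : ℕ) (e : ℕ → ℚ) :
    triangleSum N (fun _ m _ => e m) = triangleSum N (fun s _ _ => e s) :=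
  (triangleSum_rotate N (fun _ m _ => e m))

theorem triangleSum_trd (N : ℕ) (e : ℕ → ℚ) :
    triangleSum N (fun _ _ l => e l) = triangleSum N (fun s _ _ => e s) := by
  rw [triangleSum_swap_snd_trd, triangleSum_snd]

theorem triangleSum_const (N : ℕ) (a : ℚ) :
    triangleSum N (fun _ _ _ => a) = (N + 1) * (N + 2) / 2 * a := by
  rw [triangleSum_fst N (fun _ => a), ← Finset.sum_mul]
  congr 1
  induction N with
  | zero => simp
  | succ N ih =>
    rw [Finset.sum_range_succ]
    have : ∑ s ∈ Finset.range (N + 1), (((N + 1 : ℕ) : ℚ) + 1 - s) =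
        ∑ s ∈ Finset.range (N + 1), (((N : ℚ) + 1 - s) + 1) :=
      Finset.sum_congr rfl fun s _ => by push_cast; ring
    rw [this, Finset.sum_add_distrib, ih]
    simp
    ring

/-- The expected cost of the partitioning loop for `N` non-pivot elements. -/
def meanLoopCost (N : ℕ) : ℚ := 2 * totalCost N / (N + 2).factorial

theorem meanLoopCost_zero : meanLoopCost 0 = 0 := by rw [meanLoopCost, totalCost_zero]; simp

theorem meanLoopCost_succ (N : ℕ) :
    meanLoopCost (N + 1) =
      meanLoopCost N + 2 * stepCost N / (((N : ℚ) + 1) * (N + 2) * (N + 3)) := by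
  have h : ((N.factorial : ℕ) : ℚ) ≠ 0 := by exact_mod_cast N.factorial_ne_zero
  rw [meanLoopCost, meanLoopCost, totalCost_succ]
  simp only [Nat.factorial_succ]
  push_cast
  field_simp
  ring

/-- The segment lengths `s, m, l` are uniform over the `(N + 1)(N + 2)/2` triples of sum `N`. By
symmetry the three recursive terms agree, and a length `s` occurs in `N + 1 - s` triples. -/
theorem meanSwaps_rec (N : ℕ) :
    meanSwaps (N + 2) = meanLoopCost N + 2 + 6 / (((N : ℚ) + 1) * (N + 2)) *
      ∑ s ∈ Finset.range (N + 1), ((N : ℚ) + 1 - s) * meanSwaps s := by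
  have hsum : ∑ σ : Equiv.Perm (Fin (N + 2)), swapCount σ =
      2 * totalCost N + 2 * N.factorial * triangleSum N
        (fun s m l => 2 + meanSwaps s + meanSwaps m + meanSwaps l) := by
    rw [sum_swapCount]
    have hterm : ∀ σ : Equiv.Perm (Fin (N + 2)), loopSwaps σ + 2 + meanSwaps (lowPivot σ) +
        meanSwaps (highPivot σ - lowPivot σ - 1) + meanSwaps (N + 1 - highPivot σ) =
        (fun c : Fin N → Kind => loopCost N 0 c + (2 + meanSwaps (letterCount c .small) +
          meanSwaps (letterCount c .medium) + meanSwaps (letterCount c .large))) (word σ) := by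
      intro σ
      have h₁ := lowPivot_eq_letterCount σ
      have h₂ := highPivot_eq_letterCount σ
      have h₃ := letterCount_add (word σ)
      rw [loopSwaps_eq, show highPivot σ - lowPivot σ - 1 = letterCount (word σ) .medium by omega,
        show N + 1 - highPivot σ = letterCount (word σ) .large by omega, ← h₁]
      ring
    rw [Finset.sum_congr rfl fun σ _ => hterm σ,
      sum_word (fun c : Fin N → Kind => loopCost N 0 c + (2 + meanSwaps (letterCount c .small) +
        meanSwaps (letterCount c .medium) + meanSwaps (letterCount c .large))), mul_assoc 2, ← sum_weight, totalCost,
      ← sum_loopCost_eq_sum_scanCost, Finset.mul_sum, Finset.mul_sum, ← Finset.sum_add_distrib]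
    refine Finset.sum_congr rfl fun c _ => ?_
    ring
  have h : ((N.factorial : ℕ) : ℚ) ≠ 0 := by exact_mod_cast N.factorial_ne_zero
  rw [meanSwaps, hsum, triangleSum_add N (fun s m l => 2 + meanSwaps s + meanSwaps m),
    triangleSum_add N (fun s m l => 2 + meanSwaps s), triangleSum_add N (fun _ _ _ => 2),
    triangleSum_const, triangleSum_snd, triangleSum_trd, triangleSum_fst, meanLoopCost]
  generalize ∑ s ∈ Finset.range (N + 1), ((N : ℚ) + 1 - s) * meanSwaps s = S
  simp only [Nat.factorial_succ]
  push_cast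
  field_simp
  ring

end Recurrence

/-! ### Evaluation of the mean loop cost -/

section StepCost

theorem sum_antidiagonal_add_two (n : ℕ) (f : ℕ → ℕ → ℚ) :
    ∑ y ∈ Finset.HasAntidiagonal.antidiagonal (n + 2), f y.1 y.2 =
      f 0 (n + 2) + f (n + 2) 0 +
        ∑ y ∈ Finset.HasAntidiagonal.antidiagonal n, f (y.1 + 1) (y.2 + 1) := by
  rw [Finset.Nat.sum_antidiagonal_succ (f := fun y => f y.1 y.2),
    Finset.Nat.sum_antidiagonal_succ' (f := fun y => f (y.1 + 1) y.2)]
  ring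

/-- The outermost pairs `(0, 2v)` and `(2v, 0)` contribute `a` and `f 0`; removing them and lowering
both coordinates by one preserves the comparison and shifts `f`. -/
theorem sum_antidiagonal_ite_even (v : ℕ) (a : ℚ) (f : ℕ → ℚ) :
    ∑ y ∈ Finset.HasAntidiagonal.antidiagonal (2 * v), (if y.1 ≤ y.2 then a else f y.2) =
      (v + 1) * a + ∑ s ∈ Finset.range v, f s := by
  induction v generalizing f with
  | zero => simp
  | succ v ih =>
    have := sum_antidiagonal_add_two (2 * v) (fun l s => if l ≤ s then a else f s)
    simp only [add_le_add_iff_right] at this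
    rw [ih (fun s => f (s + 1))] at this
    rw [mul_add, mul_one, this, Finset.sum_range_succ']
    simp
    ring

theorem sum_antidiagonal_ite_odd (v : ℕ) (a : ℚ) (f : ℕ → ℚ) :
    ∑ y ∈ Finset.HasAntidiagonal.antidiagonal (2 * v + 1), (if y.1 ≤ y.2 then a else f y.2) =
      (v + 1) * a + ∑ s ∈ Finset.range (v + 1), f s := by
  induction v generalizing f with
  | zero => simp [Finset.Nat.sum_antidiagonal_succ]
  | succ v ih =>
    have := sum_antidiagonal_add_two (2 * v + 1) (fun l s => if l ≤ s then a else f s)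
    simp only [add_le_add_iff_right] at this
    rw [ih (fun s => f (s + 1))] at this
    rw [show 2 * (v + 1) + 1 = 2 * v + 1 + 2 by ring, this, Finset.sum_range_succ' _ (v + 1)]
    simp
    ring

theorem sum_range_linear (v : ℕ) (b : ℚ) :
    ∑ s ∈ Finset.range v, (3 / 2 * ((s : ℚ) + 1) + b) = 3 / 4 * v * (v + 1) + v * b := by
  induction v with
  | zero => simp
  | succ v ih =>
    rw [Finset.sum_range_succ, ih]
    push_cast
    ring

/-- The total cost of the next step, over all letter counts with `u` small or large letters. -/
def stepCostRow (M : ℚ) (u : ℕ) : ℚ :=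
  ∑ y ∈ Finset.HasAntidiagonal.antidiagonal u,
    if y.1 ≤ y.2 then (u : ℚ) + 2 else 3 / 2 * ((y.2 : ℚ) + 1) + (M - u)

theorem stepCostRow_even (M : ℚ) (v : ℕ) :
    stepCostRow M (2 * v) = (v + 1) * (2 * v + 2) + 3 / 4 * v * (v + 1) + v * (M - 2 * v) := by
  rw [stepCostRow, sum_antidiagonal_ite_even v _
    (fun s => 3 / 2 * ((s : ℚ) + 1) + (M - (2 * v : ℕ))), sum_range_linear]
  push_cast
  ring

theorem stepCostRow_odd (M : ℚ) (v : ℕ) :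
    stepCostRow M (2 * v + 1) = (v + 1) * (2 * v + 3) + 3 / 4 * (v + 1) * (v + 2) +
      (v + 1) * (M - 2 * v - 1) := by
  rw [stepCostRow, sum_antidiagonal_ite_odd v _
    (fun s => 3 / 2 * ((s : ℚ) + 1) + (M - (2 * v + 1 : ℕ))), sum_range_linear]
  push_cast
  ring

/-- Grouping by `u = s + l`: for `s ≥ l` the small and large letters cost `(s + 1) + (l + 1) = u +
2`; otherwise the cost is `3/2 * (s + 1)` plus `m + 1 = N + 1 - u`. -/
theorem stepCost_eq_sum (N : ℕ) :
    stepCost N = ∑ u ∈ Finset.range (N + 1), stepCostRow (N + 1) u := by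
  rw [stepCost, triangleSum_rotate, triangleSum, ← Finset.Nat.sum_antidiagonal_swap,
    Finset.Nat.sum_antidiagonal_eq_sum_range_succ_mk]
  refine Finset.sum_congr rfl fun u hu => Finset.sum_congr rfl fun y hy => ?_
  have hu' : u ≤ N := by
    rw [Finset.mem_range] at hu
    omega
  simp only [Prod.swap_prod_mk] at hy ⊢
  rw [Finset.HasAntidiagonal.mem_antidiagonal] at hy
  have hy' : (y.1 : ℚ) + y.2 = u := by exact_mod_cast hy
  simp only [readCost, Nat.cast_sub hu', sub_nonneg, Nat.cast_le]
  split_ifs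
  · rw [← hy']
    ring
  · ring

theorem sum_stepCostRow (M : ℚ) (k : ℕ) :
    ∑ u ∈ Finset.range (2 * k), stepCostRow M u =
      (k * (k - 1) * (2 * k - 1) / 4 + 9 * k * (k - 1) / 2 + 11 * k / 2 + M * k ^ 2 : ℚ) := by
  induction k with
  | zero => simp
  | succ k ih =>
    rw [mul_add, mul_one, Finset.sum_range_succ, Finset.sum_range_succ, ih, stepCostRow_even,
      stepCostRow_odd]
    push_cast
    ring

theorem stepCost_odd (k : ℕ) :
    stepCost (2 * k + 1) = 5 / 4 * (k + 1) * (k + 2) * (2 * k + 3) := by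
  rw [stepCost_eq_sum, show 2 * k + 1 + 1 = 2 * (k + 1) by ring, sum_stepCostRow]
  push_cast
  ring

theorem stepCost_even (k : ℕ) :
    stepCost (2 * k) = 1 / 2 * (k + 1) * (5 * k ^ 2 + 10 * k + 4) := by
  rw [stepCost_eq_sum, Finset.sum_range_succ, sum_stepCostRow, stepCostRow_even]
  push_cast
  ring

/-- From odd `N` to `N + 1` the increment is exactly `5/8`. From `2k` to `2k + 1` it exceeds `5/8`
by `(1/(2k+1) - 1/(2k+3))/16`, which telescopes. -/
theorem meanLoopCost_even_odd (k : ℕ) :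
    meanLoopCost (2 * k) = 5 / 4 * k + 1 / 16 * (1 - 1 / (2 * k + 1)) ∧
      meanLoopCost (2 * k + 1) = 5 / 8 * (2 * k + 1) + 1 / 16 * (1 - 1 / (2 * k + 3)) := by
  have hodd : ∀ k : ℕ, meanLoopCost (2 * k) = 5 / 4 * k + 1 / 16 * (1 - 1 / (2 * k + 1)) →
      meanLoopCost (2 * k + 1) = 5 / 8 * (2 * k + 1) + 1 / 16 * (1 - 1 / (2 * k + 3)) := by
    intro k h
    rw [meanLoopCost_succ, h, stepCost_even]
    push_cast
    field_simp
    ring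
  suffices h : meanLoopCost (2 * k) = 5 / 4 * k + 1 / 16 * (1 - 1 / (2 * k + 1)) from ⟨h, hodd k h⟩
  induction k with
  | zero => simp [meanLoopCost_zero]
  | succ k ih =>
    rw [show 2 * (k + 1) = 2 * k + 1 + 1 by ring, meanLoopCost_succ, hodd k ih, stepCost_odd]
    push_cast
    field_simp
    ring

end StepCost

/-! ### Second-order recurrence and closed form -/

section ClosedForm

/-- The second-order recurrence for the expected number of swaps. -/
theorem meanSwaps_second_order (N : ℕ) :
    ((N : ℚ) + 3) * (N + 4) / 6 * (meanSwaps (N + 4) - 2 - meanLoopCost (N + 2)) -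
        2 * (((N : ℚ) + 2) * (N + 3) / 6 * (meanSwaps (N + 3) - 2 - meanLoopCost (N + 1))) +
        ((N : ℚ) + 1) * (N + 2) / 6 * (meanSwaps (N + 2) - 2 - meanLoopCost N) =
      meanSwaps (N + 2) := by
  have h : ∀ K : ℕ, ((K : ℚ) + 1) * (K + 2) / 6 * (meanSwaps (K + 2) - 2 - meanLoopCost K) =
      ∑ s ∈ Finset.range (K + 1), ((K : ℚ) + 1 - s) * meanSwaps s := by
    intro K
    rw [meanSwaps_rec]
    field_simp
    ring
  -- Raising `K` by one raises each weight `K + 1 - s` by one, so the first difference is a plain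
  -- partial sum and the second difference is the single term `meanSwaps (N + 2)`.
  have hstep : ∀ K : ℕ, ∑ s ∈ Finset.range (K + 2), (((K + 1 : ℕ) : ℚ) + 1 - s) * meanSwaps s =
      ∑ s ∈ Finset.range (K + 1), ((K : ℚ) + 1 - s) * meanSwaps s +
        ∑ s ∈ Finset.range (K + 2), meanSwaps s := by
    intro K
    rw [Finset.sum_range_succ, Finset.sum_range_succ (fun s => meanSwaps s), ← add_assoc,
      ← Finset.sum_add_distrib]
    congr 1
    · refine Finset.sum_congr rfl fun s _ => ?_
      push_cast
      ring
    · push_cast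
      ring
  have h₀ := h N
  have h₁ := h (N + 1)
  have h₂ := h (N + 2)
  rw [hstep (N + 1), hstep N, Finset.sum_range_succ (fun s => meanSwaps s) (N + 1 + 1)] at h₂
  rw [hstep N] at h₁
  push_cast at h₁ h₂
  rw [show ((N : ℚ) + 1 + 1) = N + 2 by ring, show ((N : ℚ) + 1 + 2) = N + 3 by ring] at h₁
  rw [show ((N : ℚ) + 2 + 1) = N + 3 by ring, show ((N : ℚ) + 2 + 2) = N + 4 by ring] at h₂
  linear_combination h₂ - 2 * h₁ + h₀

theorem meanSwaps_of_le_one {n : ℕ} (h : n ≤ 1) : meanSwaps n = 0 := by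
  have : ∀ σ : Equiv.Perm (Fin n), swapCount σ = 0 := fun σ => by
    rw [swapCount, count_of_le _ (by omega)]
  simp [meanSwaps, this]

theorem meanSwaps_two : meanSwaps 2 = 2 := by
  have := meanSwaps_rec 0
  simpa [Finset.sum_range_succ, meanSwaps_of_le_one, meanLoopCost_zero] using this

theorem meanSwaps_three : meanSwaps 3 = 8 / 3 := by
  have := meanSwaps_rec 1
  have h := (meanLoopCost_even_odd 0).2
  norm_num [Finset.sum_range_succ, meanSwaps_of_le_one] at this h
  rw [this, h]
  norm_num

theorem meanSwaps_four : meanSwaps 4 = 103 / 24 := by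
  have := meanSwaps_rec 2
  have h := (meanLoopCost_even_odd 1).1
  norm_num [Finset.sum_range_succ, meanSwaps_of_le_one, meanSwaps_two] at this h
  rw [this, h]
  norm_num

theorem meanSwaps_five : meanSwaps 5 = 237 / 40 := by
  have := meanSwaps_rec 3
  have h := (meanLoopCost_even_odd 1).2
  norm_num [Finset.sum_range_succ, meanSwaps_of_le_one, meanSwaps_two, meanSwaps_three] at this h
  rw [this, h]
  norm_num

theorem expectedSwaps_eq (n : ℕ) : expectedSwaps n = meanSwaps n := by
  rw [expectedSwaps, Fintype.expect_eq_sum_div_card, meanSwaps, Fintype.card_perm,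
    Fintype.card_fin]
  push_cast
  rfl

theorem altHarmonic_succ (n : ℕ) :
    altHarmonic (n + 1) = altHarmonic n + (-1) ^ (n + 1) / ((n : ℝ) + 1) := by
  rw [altHarmonic, Finset.sum_Icc_succ_top (by omega), altHarmonic]
  push_cast
  rfl

/-- The closed form for even `n = x`, given the harmonic sums `H` and `A`. -/
noncomputable def evenForm (x H A : ℝ) : ℝ :=
  3 / 4 * (x + 1) * H + 1 / 20 * (x + 1) * A - 4 / 5 * x - 27 / 160 -
    1 / 320 * (1 / (x - 3) + 3 / (x - 1))

/-- The closed form for odd `n = x`, given the harmonic sums `H` and `A`. -/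
noncomputable def oddForm (x H A : ℝ) : ℝ :=
  3 / 4 * (x + 1) * H + 1 / 20 * (x + 1) * A - 4 / 5 * x - 19 / 160 +
    1 / 320 * (3 / (x - 2) + 1 / x)

/-- The harmonic sums are free variables here, so the step is an identity of rational functions; the
hypothesis is the second-order recurrence at `N + 2 = x`, solved for its leading term `E`. -/
theorem evenForm_step {x H A E : ℝ} (hx : 4 ≤ x)
    (h : (x + 1) * (x + 2) / 6 * (E - 2 - (5 / 8 * x + 1 / 16 * (1 - 1 / (x + 1)))) -
        2 * (x * (x + 1) / 6 * (oddForm (x + 1) (H + 1 / (x + 1)) (A - 1 / (x + 1)) - 2 -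
          (5 / 8 * (x - 1) + 1 / 16 * (1 - 1 / (x + 1))))) +
        (x - 1) * x / 6 * (evenForm x H A - 2 - (5 / 8 * (x - 2) + 1 / 16 * (1 - 1 / (x - 1)))) =
      evenForm x H A) :
    E = evenForm (x + 2) (H + 1 / (x + 1) + 1 / (x + 2)) (A - 1 / (x + 1) + 1 / (x + 2)) := by
  have h₁ : x - 1 ≠ 0 := by linarith
  have h₃ : x - 3 ≠ 0 := by linarith
  have h₀ : x ≠ 0 := by linarith
  have h₄ : x + 1 ≠ 0 := by linarith
  have h₅ : x + 2 ≠ 0 := by linarith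
  have hc : (x + 1) * (x + 2) / 6 ≠ 0 := by positivity
  apply mul_left_cancel₀ hc
  unfold evenForm oddForm at *
  rw [show x + 1 - 2 = x - 1 by ring] at h
  rw [show x + 2 - 3 = x - 1 by ring, show x + 2 - 1 = x + 1 by ring]
  rw [← sub_eq_zero] at h ⊢
  rw [← h]
  field_simp
  ring

theorem oddForm_step {x H A E : ℝ} (hx : 5 ≤ x)
    (h : (x + 1) * (x + 2) / 6 * (E - 2 - (5 / 8 * x + 1 / 16 * (1 - 1 / (x + 2)))) -
        2 * (x * (x + 1) / 6 * (evenForm (x + 1) (H + 1 / (x + 1)) (A + 1 / (x + 1)) - 2 -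
          (5 / 8 * (x - 1) + 1 / 16 * (1 - 1 / x)))) +
        (x - 1) * x / 6 * (oddForm x H A - 2 - (5 / 8 * (x - 2) + 1 / 16 * (1 - 1 / x))) =
      oddForm x H A) :
    E = oddForm (x + 2) (H + 1 / (x + 1) + 1 / (x + 2)) (A + 1 / (x + 1) - 1 / (x + 2)) := by
  have h₂ : x - 2 ≠ 0 := by linarith
  have h₀ : x ≠ 0 := by linarith
  have h₄ : x + 1 ≠ 0 := by linarith
  have h₅ : x + 2 ≠ 0 := by linarith
  have hc : (x + 1) * (x + 2) / 6 ≠ 0 := by positivity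
  apply mul_left_cancel₀ hc
  unfold evenForm oddForm at *
  rw [show x + 1 - 3 = x - 2 by ring, show x + 1 - 1 = x by ring] at h
  rw [show x + 2 - 2 = x by ring]
  rw [← sub_eq_zero] at h ⊢
  rw [← h]
  field_simp
  ring

/-- Each parity uses the two values before it: `2k + 6` comes from `2k + 4` and `2k + 5`, then `2k +
7` from `2k + 5` and `2k + 6`. The induction cannot start lower, as the formula fails at `2` and
`3`. -/
theorem meanSwaps_eq (k : ℕ) :
    (meanSwaps (2 * k + 4) : ℝ) =
        evenForm (2 * k + 4) (harmonic (2 * k + 4)) (altHarmonic (2 * k + 4)) ∧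
      (meanSwaps (2 * k + 5) : ℝ) =
        oddForm (2 * k + 5) (harmonic (2 * k + 5)) (altHarmonic (2 * k + 5)) := by
  have hH : ∀ n : ℕ, (harmonic (n + 1) : ℝ) = harmonic n + 1 / ((n : ℝ) + 1) := by
    intro n
    rw [harmonic_succ]
    push_cast
    ring
  induction k with
  | zero =>
    have hA := altHarmonic_succ
    have h₀ : altHarmonic 0 = 0 := by simp [altHarmonic]
    norm_num [meanSwaps_four, meanSwaps_five, evenForm, oddForm, harmonic,
      Finset.sum_range_succ, hA 4, hA 3, hA 2, hA 1, hA 0, h₀]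
  | succ k ih =>
    obtain ⟨he, ho⟩ := ih
    have pe : (-1 : ℝ) ^ (2 * k) = 1 := by rw [pow_mul]; simp
    have h₁ := hH (2 * k + 4)
    have h₂ := hH (2 * k + 5)
    have h₃ := hH (2 * k + 6)
    have a₁ := altHarmonic_succ (2 * k + 4)
    have a₂ := altHarmonic_succ (2 * k + 5)
    have a₃ := altHarmonic_succ (2 * k + 6)
    have z₀ := (meanLoopCost_even_odd (k + 1)).1
    have z₁ := (meanLoopCost_even_odd (k + 1)).2
    have z₂ := (meanLoopCost_even_odd (k + 2)).1
    have z₃ := (meanLoopCost_even_odd (k + 2)).2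
    have r₁ := congrArg (Rat.cast (K := ℝ)) (meanSwaps_second_order (2 * k + 2))
    have r₂ := congrArg (Rat.cast (K := ℝ)) (meanSwaps_second_order (2 * k + 3))
    rw [show 2 * (k + 1) = 2 * k + 2 by ring] at z₀ z₁
    rw [show 2 * (k + 2) = 2 * k + 4 by ring] at z₂ z₃
    simp only [z₀, z₁, z₂, z₃] at r₁ r₂
    push_cast at r₁ r₂ a₁ a₂ a₃ h₁ h₂ h₃
    have s₁ : (-1 : ℝ) ^ (2 * k + 4 + 1) = -1 := by
      rw [show 2 * k + 4 + 1 = 2 * k + 5 by ring, pow_add, pe]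
      norm_num
    have s₂ : (-1 : ℝ) ^ (2 * k + 5 + 1) = 1 := by
      rw [show 2 * k + 5 + 1 = 2 * k + 6 by ring, pow_add, pe]
      norm_num
    have s₃ : (-1 : ℝ) ^ (2 * k + 6 + 1) = -1 := by
      rw [show 2 * k + 6 + 1 = 2 * k + 7 by ring, pow_add, pe]
      norm_num
    rw [s₁, neg_div, ← sub_eq_add_neg] at a₁
    rw [s₂] at a₂
    rw [s₃, neg_div, ← sub_eq_add_neg] at a₃
    simp only [Nat.add_assoc, Nat.reduceAdd] at a₁ a₂ a₃ h₁ h₂ h₃ r₁ r₂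
    rw [show (2 * (k : ℝ) + 4 + 1) = 2 * k + 5 by ring] at a₁ h₁
    rw [show (2 * (k : ℝ) + 5 + 1) = 2 * k + 6 by ring] at a₂ h₂
    rw [show (2 * (k : ℝ) + 6 + 1) = 2 * k + 7 by ring] at a₃ h₃
    have hk : (0 : ℝ) ≤ k := Nat.cast_nonneg k
    have key₁ : (meanSwaps (2 * k + 6) : ℝ) =
        evenForm (2 * k + 6) (harmonic (2 * k + 6)) (altHarmonic (2 * k + 6)) := by
      have := evenForm_step (x := 2 * k + 4) (H := harmonic (2 * k + 4))
        (A := altHarmonic (2 * k + 4)) (E := meanSwaps (2 * k + 6)) (by linarith) (by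
          rw [show (2 * (k : ℝ) + 4 + 1) = 2 * k + 5 by ring, ← a₁, ← h₁, ← he, ← ho]
          linear_combination r₁)
      rwa [show (2 * (k : ℝ) + 4 + 1) = 2 * k + 5 by ring,
        show (2 * (k : ℝ) + 4 + 2) = 2 * k + 6 by ring, ← a₁, ← h₁, ← a₂, ← h₂] at this
    have key₂ : (meanSwaps (2 * k + 7) : ℝ) =
        oddForm (2 * k + 7) (harmonic (2 * k + 7)) (altHarmonic (2 * k + 7)) := by
      have := oddForm_step (x := 2 * k + 5) (H := harmonic (2 * k + 5))
        (A := altHarmonic (2 * k + 5)) (E := meanSwaps (2 * k + 7)) (by linarith) (by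
          rw [show (2 * (k : ℝ) + 5 + 1) = 2 * k + 6 by ring, ← a₂, ← h₂, ← ho, ← key₁]
          linear_combination r₂)
      rwa [show (2 * (k : ℝ) + 5 + 1) = 2 * k + 6 by ring,
        show (2 * (k : ℝ) + 5 + 2) = 2 * k + 7 by ring, ← a₂, ← h₂, ← a₃, ← h₃] at this
    refine ⟨?_, ?_⟩
    · rw [show 2 * (k + 1) + 4 = 2 * k + 6 by ring, key₁]
      congr 1
      push_cast
      ring
    · rw [show 2 * (k + 1) + 5 = 2 * k + 7 by ring, key₂]
      congr 1
      push_cast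
      ring

theorem expectedSwaps_closed_form (n : ℕ) (hn : 4 ≤ n) :
    expectedSwaps n =
      3 / 4 * n * (harmonic n : ℝ) + 1 / 20 * n * altHarmonic n - 4 / 5 * n
        + 3 / 4 * (harmonic n : ℝ) + 1 / 20 * altHarmonic n
        - 23 / 160 - (-1 : ℝ) ^ n / 40
        - (if Even n then (1 : ℝ) else 0) / 320 * (1 / ((n : ℝ) - 3) + 3 / ((n : ℝ) - 1))
        + (if Odd n then (1 : ℝ) else 0) / 320 * (3 / ((n : ℝ) - 2) + 1 / (n : ℝ)) := by
  rw [expectedSwaps_eq]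
  rcases Nat.even_or_odd n with h | h
  · rw [if_pos h, if_neg (Nat.not_odd_iff_even.mpr h), h.neg_one_pow]
    obtain ⟨k, rfl⟩ : ∃ k, n = 2 * k + 4 := by
      obtain ⟨m, rfl⟩ := h
      exact ⟨m - 2, by omega⟩
    rw [(meanSwaps_eq k).1, evenForm]
    push_cast
    ring
  · rw [if_pos h, if_neg (Nat.not_even_iff_odd.mpr h), h.neg_one_pow]
    obtain ⟨k, rfl⟩ : ∃ k, n = 2 * k + 5 := by
      obtain ⟨m, rfl⟩ := h
      exact ⟨m - 2, by omega⟩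
    rw [(meanSwaps_eq k).2, oddForm]
    push_cast
    ring

end ClosedForm

/-! ### Estimates for harmonic sums, the numerical constant and the expansion -/

section Asymptotics

theorem harmonic_succ_real (n : ℕ) :
    (harmonic (n + 1) : ℝ) = harmonic n + 1 / ((n : ℝ) + 1) := by
  rw [harmonic_succ]
  push_cast
  ring

/-- The bound `2x/(x + 2) ≤ log (1 + x)` at `x = 1/(n + 1/2)` has left side exactly `1/(n + 1)`. The
shift by `1/2` makes the convergence to `γ` fast enough for a small `n` to suffice numerically. -/
theorem antitone_harmonic_sub_log_add_half :
    Antitone fun n : ℕ => (harmonic n : ℝ) - Real.log ((n : ℝ) + 1 / 2) := by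
  refine antitone_nat_of_succ_le fun n => ?_
  have hn : (0 : ℝ) ≤ n := Nat.cast_nonneg n
  have hx : (0 : ℝ) ≤ 1 / ((n : ℝ) + 1 / 2) := by positivity
  have h := Real.le_log_one_add_of_nonneg hx
  have h₁ : 2 * (1 / ((n : ℝ) + 1 / 2)) / (1 / ((n : ℝ) + 1 / 2) + 2) = 1 / ((n : ℝ) + 1) := by
    field_simp
    ring
  have h₂ : Real.log (((n + 1 : ℕ) : ℝ) + 1 / 2) =
      Real.log ((n : ℝ) + 1 / 2) + Real.log (1 + 1 / ((n : ℝ) + 1 / 2)) := by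
    rw [← Real.log_mul (by positivity) (by positivity)]
    congr 1
    push_cast
    field_simp
    ring
  rw [harmonic_succ_real, h₂]
  linarith

theorem eulerMascheroniConstant_le_harmonic (n : ℕ) :
    Real.eulerMascheroniConstant ≤ harmonic n - Real.log ((n : ℝ) + 1 / 2) := by
  refine le_of_tendsto Real.tendsto_harmonic_sub_log_add_one ?_
  filter_upwards [eventually_ge_atTop n] with m hm
  refine le_trans ?_ (antitone_harmonic_sub_log_add_half hm)
  have : Real.log ((m : ℝ) + 1 / 2) ≤ Real.log ((m : ℝ) + 1) :=
    Real.log_le_log (by positivity) (by linarith)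
  simp only
  linarith

theorem log_le_half_sub_inv {x : ℝ} (hx : 1 ≤ x) : Real.log x ≤ (x - x⁻¹) / 2 := by
  rw [← Real.sinh_log (by linarith), Real.self_le_sinh_iff]
  exact Real.log_nonneg hx

/-- The trapezoidal counterpart from below: `log x ≤ (x - 1/x)/2` at `x = (n + 2)/(n + 1)` gives the
mean of `1/(n + 1)` and `1/(n + 2)`. -/
theorem monotone_harmonic_sub_log_sub :
    Monotone fun n : ℕ => (harmonic (n + 1) : ℝ) - Real.log ((n : ℝ) + 1) -
      1 / (2 * ((n : ℝ) + 1)) := by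
  refine monotone_nat_of_le_succ fun n => ?_
  have hn : (0 : ℝ) ≤ n := Nat.cast_nonneg n
  have h := log_le_half_sub_inv (x := 1 + 1 / ((n : ℝ) + 1)) (by
    have : (0 : ℝ) ≤ 1 / ((n : ℝ) + 1) := by positivity
    linarith)
  have h₁ : (1 + 1 / ((n : ℝ) + 1) - (1 + 1 / ((n : ℝ) + 1))⁻¹) / 2 =
      1 / (2 * ((n : ℝ) + 1)) + 1 / (2 * ((n : ℝ) + 2)) := by
    have : (n : ℝ) + 1 + 1 ≠ 0 := by positivity
    have : 1 + 1 / ((n : ℝ) + 1) = (n + 2) / (n + 1) := by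
      field_simp
      ring
    rw [this, inv_div]
    field_simp
    ring
  have h₂ : Real.log (((n + 1 : ℕ) : ℝ) + 1) =
      Real.log ((n : ℝ) + 1) + Real.log (1 + 1 / ((n : ℝ) + 1)) := by
    rw [← Real.log_mul (by positivity) (by positivity)]
    congr 1
    push_cast
    field_simp
  have h₃ : 1 / (((n + 1 : ℕ) : ℝ) + 1) = 2 * (1 / (2 * ((n : ℝ) + 2))) := by
    push_cast
    field_simp
    ring
  have h₄ : 1 / (2 * (((n + 1 : ℕ) : ℝ) + 1)) = 1 / (2 * ((n : ℝ) + 2)) := by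
    push_cast
    congr 1
    ring
  rw [harmonic_succ_real (n + 1), h₂, h₃, h₄]
  linarith

theorem harmonic_le_eulerMascheroniConstant (n : ℕ) :
    (harmonic (n + 1) : ℝ) - Real.log ((n : ℝ) + 1) - 1 / (2 * ((n : ℝ) + 1)) ≤
      Real.eulerMascheroniConstant := by
  refine ge_of_tendsto ((tendsto_add_atTop_iff_nat 1).mpr Real.tendsto_harmonic_sub_log) ?_
  filter_upwards [eventually_ge_atTop n] with m hm
  refine le_trans (monotone_harmonic_sub_log_sub hm) ?_
  have : 0 ≤ 1 / (2 * ((m : ℝ) + 1)) := by positivity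
  push_cast
  linarith

theorem linearCoeff_bounds : -0.402 < linearCoeff ∧ linearCoeff < -0.401 := by
  have l₁ := Real.log_two_gt_d9
  have l₂ := Real.log_two_lt_d9
  -- The indices are chosen so that the logarithms reduce to `log 2`: `16 + 1/2 = 2^4 * (1 + 1/32)`
  -- and `31 + 1 = 2^5`.
  have hup := eulerMascheroniConstant_le_harmonic 16
  have hlo := harmonic_le_eulerMascheroniConstant 31
  have h₁ : Real.log (((16 : ℕ) : ℝ) + 1 / 2) = 4 * Real.log 2 + Real.log (1 + 1 / 32) := by
    rw [show (4 : ℝ) * Real.log 2 = Real.log (2 ^ 4) by rw [Real.log_pow]; norm_num,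
      ← Real.log_mul (by norm_num) (by norm_num)]
    norm_num
  have h₂ : Real.log (((31 : ℕ) : ℝ) + 1) = 5 * Real.log 2 := by
    rw [show (5 : ℝ) * Real.log 2 = Real.log (2 ^ 5) by rw [Real.log_pow]; norm_num]
    norm_num
  have h₃ := Real.le_log_one_add_of_nonneg (x := 1 / 32) (by norm_num)
  have h₄ : (harmonic 16 : ℝ) ≤ 338073 / 100000 := by
    have : harmonic 16 ≤ 338073 / 100000 := by norm_num [harmonic, Finset.sum_range_succ]
    simpa using (Rat.cast_le (K := ℝ)).mpr this
  have h₅ : (405849 / 100000 : ℝ) ≤ harmonic 32 := by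
    have : 405849 / 100000 ≤ harmonic 32 := by norm_num [harmonic, Finset.sum_range_succ]
    simpa using (Rat.cast_le (K := ℝ)).mpr this
  rw [h₁] at hup
  rw [h₂] at hlo
  norm_num at hlo h₃ h₄ h₅ l₁ l₂ hup
  unfold linearCoeff
  constructor <;> norm_num <;> linarith

theorem harmonic_sub_log_sub_bounds {n : ℕ} (hn : 1 ≤ n) :
    0 ≤ (harmonic n : ℝ) - Real.log n - Real.eulerMascheroniConstant ∧
      (harmonic n : ℝ) - Real.log n - Real.eulerMascheroniConstant ≤ 1 / n := by
  have hpos : (0 : ℝ) < n := by exact_mod_cast hn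
  have h₁ := Real.eulerMascheroniSeq_lt_eulerMascheroniConstant n
  have h₂ := Real.eulerMascheroniConstant_lt_eulerMascheroniSeq' n
  rw [Real.eulerMascheroniSeq] at h₁
  rw [Real.eulerMascheroniSeq', if_neg (by omega)] at h₂
  have h₃ : Real.log ((n : ℝ) + 1) ≤ Real.log n + 1 / n := by
    have h := Real.log_le_sub_one_of_pos (x := ((n : ℝ) + 1) / n) (by positivity)
    rw [Real.log_div (by positivity) (by positivity), add_div, div_self hpos.ne'] at h
    linarith
  constructor <;> linarith

/-- Adding the full harmonic sum cancels the odd terms and doubles the even ones, `2/(2k) = 1/k`. In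
the difference `γ` cancels and `-log 2` remains. -/
theorem altHarmonic_two_mul (m : ℕ) :
    altHarmonic (2 * m) = (harmonic m : ℝ) - harmonic (2 * m) := by
  induction m with
  | zero => simp [altHarmonic]
  | succ m ih =>
    have pe : (-1 : ℝ) ^ (2 * m) = 1 := by rw [pow_mul]; simp
    have pe' : (-1 : ℝ) ^ (2 * m + 1) = -1 := by rw [pow_succ, pe, one_mul]
    have pe'' : (-1 : ℝ) ^ (2 * m + 1 + 1) = 1 := by rw [pow_succ, pe']; norm_num
    rw [show 2 * (m + 1) = 2 * m + 1 + 1 by ring, altHarmonic_succ, altHarmonic_succ, ih,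
      harmonic_succ_real m, harmonic_succ_real (2 * m + 1), harmonic_succ_real (2 * m), pe', pe'']
    push_cast
    field_simp
    ring

theorem abs_altHarmonic_add_log_two_le {n : ℕ} (hn : 2 ≤ n) :
    |altHarmonic n + Real.log 2| ≤ 4 / n := by
  have key : ∀ m : ℕ, 1 ≤ m → |altHarmonic (2 * m) + Real.log 2| ≤ 1 / m := by
    intro m hm
    have hpos : (0 : ℝ) < m := by exact_mod_cast hm
    obtain ⟨h₁, h₂⟩ := harmonic_sub_log_sub_bounds hm
    obtain ⟨h₃, h₄⟩ := harmonic_sub_log_sub_bounds (n := 2 * m) (by omega)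
    have hlog : Real.log ((2 * m : ℕ) : ℝ) = Real.log 2 + Real.log m := by
      push_cast
      rw [Real.log_mul (by norm_num) hpos.ne']
    have hle : 1 / ((2 * m : ℕ) : ℝ) ≤ 1 / m := by
      push_cast
      exact one_div_le_one_div_of_le hpos (by linarith)
    rw [altHarmonic_two_mul, abs_le]
    constructor <;> linarith
  obtain ⟨m, rfl | rfl⟩ : ∃ m, n = 2 * m ∨ n = 2 * m + 1 := ⟨n / 2, by omega⟩
  · have hpos : (0 : ℝ) < m := by
      have : 0 < m := by omega
      exact_mod_cast this
    refine (key m (by omega)).trans ?_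
    push_cast
    rw [div_le_div_iff₀ hpos (by positivity)]
    linarith
  · have hm : (1 : ℝ) ≤ m := by
      have : 1 ≤ m := by omega
      exact_mod_cast this
    have pe : (-1 : ℝ) ^ (2 * m) = 1 := by rw [pow_mul]; simp
    rw [altHarmonic_succ, pow_succ, pe]
    push_cast
    have h := key m (by omega)
    have h₁ : |1 * -1 / (2 * (m : ℝ) + 1)| = 1 / (2 * m + 1) := by
      rw [one_mul, neg_div, abs_neg, abs_of_pos (by positivity)]
    have h₂ : 1 / (m : ℝ) ≤ 3 / (2 * m + 1) := by
      rw [div_le_div_iff₀ (by positivity) (by positivity)]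
      linarith
    have h₃ : (3 : ℝ) / (2 * m + 1) + 1 / (2 * m + 1) = 4 / (2 * m + 1) := by ring
    calc _ = |(altHarmonic (2 * m) + Real.log 2) + 1 * -1 / (2 * (m : ℝ) + 1)| := by ring_nf
      _ ≤ _ := abs_add_le _ _
      _ ≤ _ := by linarith

theorem expectedSwaps_sub_isBigO :
    (fun n : ℕ => expectedSwaps n -
        (3 / 4 * n * Real.log n + linearCoeff * n + 3 / 4 * Real.log n))
      =O[atTop] (fun _ : ℕ => (1 : ℝ)) := by
  refine IsBigO.of_bound 10 ?_
  filter_upwards [eventually_ge_atTop 4] with n hn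
  have hn' : (4 : ℝ) ≤ n := by exact_mod_cast hn
  have hpos : (0 : ℝ) < n := by linarith
  obtain ⟨h₁, h₂⟩ := harmonic_sub_log_sub_bounds (n := n) (by omega)
  have h₃ := abs_altHarmonic_add_log_two_le (n := n) (by omega)
  set δ := (harmonic n : ℝ) - Real.log n - Real.eulerMascheroniConstant with hδ
  set ε := altHarmonic n + Real.log 2 with hε
  have hH : (harmonic n : ℝ) = Real.log n + Real.eulerMascheroniConstant + δ := by
    rw [hδ]
    ring
  have hA : altHarmonic n = ε - Real.log 2 := by
    rw [hε]
    ring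
  -- The closed form multiplies both harmonic sums by `n`, so errors of order `1/n` are needed to
  -- stay bounded. The constant `10` above is generous.
  have hnδ : 0 ≤ n * δ ∧ n * δ ≤ 1 := by
    refine ⟨by positivity, ?_⟩
    calc n * δ ≤ n * (1 / n) := by gcongr
      _ = 1 := by field_simp
  have hnε : |n * ε| ≤ 4 := by
    rw [abs_mul, abs_of_pos hpos]
    calc n * |ε| ≤ n * (4 / n) := by gcongr
      _ = 4 := by field_simp
  have hδ₁ : δ ≤ 1 := h₂.trans (by rw [div_le_one hpos]; linarith)
  have hε₁ : |ε| ≤ 1 := h₃.trans (by rw [div_le_one hpos]; linarith)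
  have hsmall : ∀ x : ℝ, 1 ≤ x → 0 ≤ 1 / x ∧ 1 / x ≤ 1 := fun x hx =>
    ⟨by positivity, by rw [div_le_one (by linarith)]; exact hx⟩
  obtain ⟨i₁, j₁⟩ := hsmall (n - 3) (by linarith)
  obtain ⟨i₂, j₂⟩ := hsmall (n - 1) (by linarith)
  obtain ⟨i₃, j₃⟩ := hsmall (n - 2) (by linarith)
  obtain ⟨i₄, j₄⟩ := hsmall n (by linarith)
  have g₁ := Real.one_half_lt_eulerMascheroniConstant
  have g₂ := Real.eulerMascheroniConstant_lt_two_thirds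
  have l₁ := Real.log_two_gt_d9
  have l₂ := Real.log_two_lt_d9
  rw [abs_le] at hnε hε₁
  rw [norm_one, mul_one, Real.norm_eq_abs, expectedSwaps_closed_form n hn, linearCoeff, hH, hA]
  rcases Nat.even_or_odd n with h | h
  · rw [if_pos h, if_neg (Nat.not_odd_iff_even.mpr h), h.neg_one_pow,
      show (3 : ℝ) / ((n : ℝ) - 1) = 3 * (1 / ((n : ℝ) - 1)) by ring, abs_le]
    norm_num at l₁ l₂
    constructor <;> linarith
  · rw [if_pos h, if_neg (Nat.not_even_iff_odd.mpr h), h.neg_one_pow,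
      show (3 : ℝ) / ((n : ℝ) - 2) = 3 * (1 / ((n : ℝ) - 2)) by ring, abs_le]
    norm_num at l₁ l₂
    constructor <;> linarith

end Asymptotics

end DualPivotCount

theorem theorem1 :
    (∀ n : ℕ, 4 ≤ n →
      DualPivotCount.expectedSwaps n =
        3 / 4 * n * (harmonic n : ℝ) + 1 / 20 * n * DualPivotCount.altHarmonic n - 4 / 5 * n
          + 3 / 4 * (harmonic n : ℝ) + 1 / 20 * DualPivotCount.altHarmonic n
          - 23 / 160 - (-1 : ℝ) ^ n / 40
          - (if Even n then (1 : ℝ) else 0) / 320 * (1 / ((n : ℝ) - 3) + 3 / ((n : ℝ) - 1))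
          + (if Odd n then (1 : ℝ) else 0) / 320 * (3 / ((n : ℝ) - 2) + 1 / (n : ℝ))) ∧
    ((fun n : ℕ => DualPivotCount.expectedSwaps n -
        (3 / 4 * n * Real.log n + DualPivotCount.linearCoeff * n + 3 / 4 * Real.log n))
      =O[atTop] (fun _ : ℕ => (1 : ℝ))) ∧
    (-0.402 < DualPivotCount.linearCoeff ∧ DualPivotCount.linearCoeff < -0.401) :=
  ⟨DualPivotCount.expectedSwaps_closed_form, DualPivotCount.expectedSwaps_sub_isBigO,
    DualPivotCount.linearCoeff_bounds⟩
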